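/- Let $\mathscr{H}^1$ denote the one-dimensional Hausdorff measure. For a path (continuous map) $\gamma:[0,1]\to X$ in a metric space $(X,d)$, let $m(\gamma,x):=\#(\gamma^{-1}(x))\in\{0,1,2,\dots,+\infty\}$ be its multiplicity at $x\in X$, let $\mathrm{length}(\gamma,[t_0,t_1])$ be the supremum of $\sum_{i=1}^n d(\gamma(s_{i-1}),\gamma(s_i))$ over all finite increasing sequences $s_0\le\dots\le s_n$ in $[t_0,t_1]$, and put $\mathrm{length}(\gamma):=\mathrm{length}(\gamma,[0,1])$. The path is closed if $\gamma(0)=\gamma(1)$. It has constant speed $c\in[0,\infty)$ if $\mathrm{length}(\gamma,[t_0,t_1])=c\,(t_1-t_0)$ for every $[t_0,t_1]\subset[0,1]$. A Lipschitz path $\gamma$ has degree zero if \[ \int_0^1 f(\gamma(t))\,\frac{d}{dt}\bigl(g(\gamma(t))\bigr)\,dt=0\qquad\text{for all Lipschitz functions } f,g:X\to\mathbb{R}. \] (A) Let $X$ be a continuum (that is, a nonempty, compact, connected metric space) with $\mathscr{H}^1(X)<+\infty$. Then there exists a path $\gamma:[0,1]\to X$ such that: (i) $\gamma$ is closed, Lipschitz,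 surjective, and has degree zero; (ii) $m(\gamma,x)=2$ for $\mathscr{H}^1$-a.e. $x\in X$, and $\mathrm{length}(\gamma)=2\,\mathscr{H}^1(X)$; (iii) $\gamma$ has constant speed, equal to $2\,\mathscr{H}^1(X)$. (B) (Gołąb's theorem for $m=1$.) Let $X$ be any metric space, and let $\mathscr{F}_1$ be the class of all nonempty compact connected subsets of $X$, endowed with the Hausdorff distance. Then the function $K\mapsto\mathscr{H}^1(K)\in[0,+\infty]$ is lower semicontinuous on $\mathscr{F}_1$. -/

import Mathlib

open MeasureTheory Set TopologicalSpace
open scoped NNReal ENNReal unitInterval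

noncomputable section

variable {X : Type*}

/-- The multiplicity `m(γ, x) = #(γ⁻¹(x))` of a map `γ : [0,1] → X` at `x`, possibly infinite. -/
def pathMultiplicity (γ : I → X) (x : X) : ℕ∞ :=
  (γ ⁻¹' {x}).encard

/-- The length of `γ : [0,1] → X` relative to the interval `[t₀, t₁] ⊆ [0,1]`: the supremum of
`∑ d(γ(sᵢ₋₁), γ(sᵢ))` over all finite increasing sequences `s₀ ≤ ⋯ ≤ sₙ` in `[t₀, t₁]`. -/
def pathLengthOn [MetricSpace X] (γ : I → X) (t₀ t₁ : I) : ℝ≥0∞ :=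
  eVariationOn γ (Icc t₀ t₁)

/-- The length of `γ : [0,1] → X`. -/
def pathLength [MetricSpace X] (γ : I → X) : ℝ≥0∞ :=
  pathLengthOn γ 0 1

/-- `γ` has constant speed `c`: `length(γ, [t₀, t₁]) = c (t₁ - t₀)` for all
`[t₀, t₁] ⊆ [0,1]`. -/
def HasConstantSpeed [MetricSpace X] (γ : I → X) (c : ℝ≥0) : Prop :=
  ∀ t₀ t₁ : I, t₀ ≤ t₁ → pathLengthOn γ t₀ t₁ = c * ENNReal.ofReal ((t₁ : ℝ) - t₀)

/-- The integral `∫_γ f dg = ∫₀¹ f(γ(t)) (d/dt) g(γ(t)) dt`. To speak of the derivative, `γ` is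
extended to `ℝ` by its end values; this does not affect derivatives at points of `(0,1)`. -/
def pathIntegral (γ : I → X) (f g : X → ℝ) : ℝ :=
  ∫ t in (0 : ℝ)..1, f (IccExtend zero_le_one γ t) *
    deriv (fun s : ℝ => g (IccExtend zero_le_one γ s)) t

/-- A (Lipschitz) path `γ` has degree zero if `∫_γ f dg = 0` for all Lipschitz
`f, g : X → ℝ`. -/
def HasDegreeZero [MetricSpace X] (γ : I → X) : Prop :=
  ∀ f g : X → ℝ, (∃ K : ℝ≥0, LipschitzWith K f) → (∃ K : ℝ≥0, LipschitzWith K g) →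
    pathIntegral γ f g = 0

end

/-! A closed path of degree zero is built with length at most twice that of `X`. Degree zero also
forces the opposite inequality, and equality gives the multiplicity and the speed.

Upper bound. Starting from a constant path, a point `q` is added to a tour by a shortest path from
`q` to the image already covered, inserted as an out-and-back excursion (`IsTour.exists_extension`).
The two passes cancel in `∫ f dg`, so the degree stays zero. A shortest path of duration `ℓ` is
injective, meets the old image only at its end, and its trace has measure at least `ℓ`
(`exists_path_to_closed`). The excursion therefore costs time `2ℓ` and adds at least `ℓ` to the
measure of the image. Shortest paths exist by compactness once some Lipschitz path exists; such a
path is a limit of `ε`-chains, whose number of steps is controlled by disjoint balls. Tours through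
finite sets, rescaled to `[0,1]`, are equi-Lipschitz with constant `2 μH[1] univ`. An ultralimit
along the finite sets is surjective, and it has degree zero because degree zero is stable under
uniform equi-Lipschitz limits.

Lower bound. Testing degree zero with `f` concentrated near the image of a compact set of simple
times gives `(g ∘ γ)' = 0` a.e. on the simple times, for every Lipschitz `g`. Their image is then
null, so almost every point of the image is attained at least twice. Fatou's lemma for a discretized
multiplicity bounds the integral of the multiplicity by the length, so the length is at least `2
μH[1] (γ '' Icc 0 1)`.

Gołąb's theorem follows from the same two facts. If connected sets `K` with `μH[1] K ≤ y` accumulate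
at `K₀`, their degree-zero parametrizations have an ultralimit of degree zero which covers `K₀` and
has length at most `2y`. Hence `2 μH[1] K₀ ≤ 2y`. -/

section

open Filter
open scoped Topology

/-- `∫₀ᵀ f(γ(t)) (d/dt) g(γ(t)) dt = 0` for all Lipschitz functions `f`, `g`. -/
def DegreeZeroOn {X : Type*} [PseudoMetricSpace X] (γ : ℝ → X) (T : ℝ) : Prop :=
  ∀ f g : X → ℝ, (∃ K : ℝ≥0, LipschitzWith K f) → (∃ K : ℝ≥0, LipschitzWith K g) →
    ∫ t in (0 : ℝ)..T, f (γ t) * deriv (fun s => g (γ s)) t = 0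

lemma LipschitzWith.absolutelyContinuousOnInterval {f : ℝ → ℝ} {K : ℝ≥0} (hf : LipschitzWith K f)
    (a b : ℝ) : AbsolutelyContinuousOnInterval f a b :=
  hf.lipschitzOnWith.absolutelyContinuousOnInterval

lemma LipschitzWith.intervalIntegrable_deriv {f : ℝ → ℝ} {K : ℝ≥0} (hf : LipschitzWith K f)
    (a b : ℝ) : IntervalIntegrable (deriv f) volume a b :=
  (hf.absolutelyContinuousOnInterval a b).intervalIntegrable_deriv

lemma LipschitzWith.intervalIntegrable_mul_deriv {u v : ℝ → ℝ} {K : ℝ≥0}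
    (hu : Continuous u) (hv : LipschitzWith K v) (a b : ℝ) :
    IntervalIntegrable (fun t => u t * deriv v t) volume a b :=
  (hv.intervalIntegrable_deriv a b).continuousOn_mul hu.continuousOn

/-! ### Degree zero: stability under limits, and negligibility of the values attained once. -/

section degreeZero

variable {X : Type*} [MetricSpace X]

/-- Degree zero is stable under uniform limits of equi-Lipschitz paths. -/
lemma DegreeZeroOn.of_tendstoUniformlyOn {ι : Type*} {U : Filter ι} [U.NeBot] {F : ι → ℝ → X}
    {γ : ℝ → X} {c : ℝ≥0} (hF : ∀ᶠ i in U, LipschitzWith c (F i))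
    (hγ : LipschitzWith c γ) (hdeg : ∀ᶠ i in U, DegreeZeroOn (F i) 1)
    (hlim : TendstoUniformlyOn F γ U (Icc 0 1)) : DegreeZeroOn γ 1 := by
  rintro f g ⟨Kf, hf⟩ ⟨Kg, hg⟩
  -- The first two terms come from the boundary in an integration by parts, the other two from the
  -- two remaining integrals.
  set M : ℝ := |f (γ 0)| + |f (γ 1)| + Kf * c + Kf * c with hM
  have key : ∀ ε > 0, |∫ t in (0 : ℝ)..1, f (γ t) * deriv (fun s => g (γ s)) t| ≤
      (Kg * M) * ε := by
    intro ε hε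
    obtain ⟨i, hi, hdi, hui⟩ := (hF.and (hdeg.and
      (Metric.tendstoUniformlyOn_iff.1 hlim ε hε))).exists
    have hu := hf.comp hγ
    have hui' := hf.comp hi
    have hv := hg.comp hγ
    have hvi := hg.comp hi
    have hw := hv.sub hvi
    have h0 := hdi f g ⟨Kf, hf⟩ ⟨Kg, hg⟩
    have hvd : ∀ᵐ t, DifferentiableAt ℝ (g ∘ γ) t := hv.ae_differentiableAt
    have hvid : ∀ᵐ t, DifferentiableAt ℝ (g ∘ F i) t := hvi.ae_differentiableAt
    -- The vanishing integral for `F i` is subtracted, and the difference of products is split.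
    have e1 : ∫ t in (0 : ℝ)..1, f (γ t) * deriv (fun s => g (γ s)) t =
        (∫ t in (0 : ℝ)..1, (f ∘ γ) t * deriv (fun t => (g ∘ γ) t - (g ∘ F i) t) t) +
        (∫ t in (0 : ℝ)..1, ((f ∘ γ) t - (f ∘ F i) t) * deriv (g ∘ F i) t) := by
      rw [← intervalIntegral.integral_add (hw.intervalIntegrable_mul_deriv hu.continuous 0 1)
        (hvi.intervalIntegrable_mul_deriv (u := fun t => (f ∘ γ) t - (f ∘ F i) t)
          (hu.continuous.sub hui'.continuous) 0 1),
        ← sub_zero (∫ t in (0 : ℝ)..1, f (γ t) * deriv (fun s => g (γ s)) t)]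
      refine (congrArg _ h0.symm).trans ?_
      refine (intervalIntegral.integral_sub (hv.intervalIntegrable_mul_deriv hu.continuous 0 1)
        (hvi.intervalIntegrable_mul_deriv hui'.continuous 0 1)).symm.trans ?_
      apply intervalIntegral.integral_congr_ae
      filter_upwards [hvd, hvid] with t h1 h2 _
      rw [deriv_fun_sub h1 h2]
      simp only [Function.comp_def]
      ring
    have hb : ∀ t ∈ Icc (0 : ℝ) 1, |(g ∘ γ) t - (g ∘ F i) t| ≤ Kg * ε := fun t ht => by
      have := (hg.dist_le_mul (γ t) (F i t)).trans
        (mul_le_mul_of_nonneg_left (hui t ht).le Kg.2)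
      simpa [Real.dist_eq] using this
    have hb' : ∀ t ∈ Icc (0 : ℝ) 1, |(f ∘ γ) t - (f ∘ F i) t| ≤ Kf * ε := fun t ht => by
      have := (hf.dist_le_mul (γ t) (F i t)).trans
        (mul_le_mul_of_nonneg_left (hui t ht).le Kf.2)
      simpa [Real.dist_eq] using this
    -- Uniform closeness makes `g ∘ γ - g ∘ F i` small but not its derivative, so the derivative is
    -- moved onto `f ∘ γ`.
    have e2 := (hu.absolutelyContinuousOnInterval 0 1).integral_mul_deriv_eq_deriv_mul
      (hw.absolutelyContinuousOnInterval 0 1)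
    have e3 : |∫ t in (0 : ℝ)..1, deriv (f ∘ γ) t * ((g ∘ γ) t - (g ∘ F i) t)| ≤
        (Kf * c) * (Kg * ε) := by
      have := intervalIntegral.norm_integral_le_of_norm_le_const (a := (0 : ℝ)) (b := 1)
        (C := (Kf * c) * (Kg * ε))
        (f := fun t => deriv (f ∘ γ) t * ((g ∘ γ) t - (g ∘ F i) t)) fun t ht => by
          rw [uIoc_of_le zero_le_one] at ht
          rw [norm_mul]
          exact mul_le_mul (by simpa using norm_deriv_le_of_lipschitz hu) (hb t ⟨ht.1.le, ht.2⟩)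
            (norm_nonneg _) (by positivity)
      simpa using this
    have e4 : |∫ t in (0 : ℝ)..1, ((f ∘ γ) t - (f ∘ F i) t) * deriv (g ∘ F i) t| ≤
        (Kf * ε) * (Kg * c) := by
      have := intervalIntegral.norm_integral_le_of_norm_le_const (a := (0 : ℝ)) (b := 1)
        (C := (Kf * ε) * (Kg * c))
        (f := fun t => ((f ∘ γ) t - (f ∘ F i) t) * deriv (g ∘ F i) t) fun t ht => by
          rw [uIoc_of_le zero_le_one] at ht
          rw [norm_mul]
          exact mul_le_mul (hb' t ⟨ht.1.le, ht.2⟩) (by simpa using norm_deriv_le_of_lipschitz hvi)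
            (norm_nonneg _) (by positivity)
      simpa using this
    have e5 : |(f ∘ γ) 1 * ((g ∘ γ) 1 - (g ∘ F i) 1)| ≤ |f (γ 1)| * (Kg * ε) := by
      rw [abs_mul]
      exact mul_le_mul_of_nonneg_left (hb 1 (by simp)) (abs_nonneg _)
    have e6 : |(f ∘ γ) 0 * ((g ∘ γ) 0 - (g ∘ F i) 0)| ≤ |f (γ 0)| * (Kg * ε) := by
      rw [abs_mul]
      exact mul_le_mul_of_nonneg_left (hb 0 (by simp)) (abs_nonneg _)
    rw [e1, e2, hM]
    rw [abs_le] at *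
    constructor <;> nlinarith
  rw [← abs_nonpos_iff]
  refine le_of_forall_pos_le_add fun ε hε => ?_
  have hM0 : 0 ≤ Kg * M := by positivity
  refine (key (ε / (Kg * M + 1)) (by positivity)).trans ?_
  rw [zero_add, mul_div_assoc', div_le_iff₀ (by positivity)]
  nlinarith

/-- The times in `[0, 1]` whose value is attained only once. -/
def simpleTimes {X : Type*} (γ : ℝ → X) : Set ℝ :=
  {t | t ∈ Icc (0 : ℝ) 1 ∧ ∀ s ∈ Icc (0 : ℝ) 1, γ s = γ t → s = t}

/-- The other times form a countable union of projections of compact sets: pairs with equal values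
at distance at least `1 / (n + 1)`. -/
lemma measurableSet_simpleTimes {γ : ℝ → X} (hγ : Continuous γ) :
    MeasurableSet (simpleTimes γ) := by
  have h : simpleTimes γ = Icc 0 1 \ ⋃ n : ℕ, Prod.fst '' {p : ℝ × ℝ |
      p ∈ Icc (0 : ℝ) 1 ×ˢ Icc (0 : ℝ) 1 ∧ (γ p.2 = γ p.1 ∧ 1 / ((n : ℝ) + 1) ≤ |p.2 - p.1|)} := by
    ext t
    refine and_congr_right fun ht => ⟨fun h hmem => ?_, fun h s hs e => ?_⟩
    · obtain ⟨n, ⟨_, s⟩, ⟨hs, e, hn⟩, rfl⟩ := mem_iUnion.1 hmem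
      simp only [h s hs.2 e, sub_self, abs_zero] at hn
      exact absurd hn (by positivity : (0 : ℝ) < 1 / ((n : ℝ) + 1)).not_ge
    · by_contra hne
      obtain ⟨n, hn⟩ := exists_nat_one_div_lt (abs_pos.2 (sub_ne_zero.2 hne))
      exact h (mem_iUnion.2 ⟨n, (t, s), ⟨⟨ht, hs⟩, e, hn.le⟩, rfl⟩)
  rw [h]
  refine measurableSet_Icc.diff (MeasurableSet.iUnion fun n => ?_)
  refine IsCompact.measurableSet (IsCompact.image ?_ continuous_fst)
  refine (isCompact_Icc.prod isCompact_Icc).inter_right (IsClosed.inter ?_ ?_)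
  · exact isClosed_eq (hγ.comp continuous_snd) (hγ.comp continuous_fst)
  · exact isClosed_le continuous_const (continuous_snd.sub continuous_fst).abs

/-- Lipschitz cutoffs `f n` decrease to the indicator of `γ '' K`. Because values at simple times
are not attained again, this indicator composed with `γ` is the indicator of `K` on `[0,1]`, and
dominated convergence applies. -/
lemma DegreeZeroOn.setIntegral_deriv_eq_zero {γ : ℝ → X} {c : ℝ≥0} (hγ : LipschitzWith c γ)
    (hdeg : DegreeZeroOn γ 1) {g : X → ℝ} {Kg : ℝ≥0} (hg : LipschitzWith Kg g)
    {K : Set ℝ} (hK : IsCompact K) (hKS : K ⊆ simpleTimes γ) :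
    ∫ t in K, deriv (fun s => g (γ s)) t = 0 := by
  have hpos : ∀ n : ℕ, (0 : ℝ) < 1 / ((n : ℝ) + 1) := fun n => by positivity
  have hcl : IsClosed (γ '' K) := (hK.image hγ.continuous).isClosed
  set f : ℕ → X → ℝ := fun n x => (thickenedIndicator (hpos n) (γ '' K) x : ℝ) with hf
  have hfl : ∀ n : ℕ, LipschitzWith (1 / (((n : ℕ) : ℝ) + 1)).toNNReal⁻¹ (f n) := fun n =>
    LipschitzWith.of_dist_le_mul fun x y =>
      (lipschitzWith_thickenedIndicator (hpos n) (γ '' K)).dist_le_mul x y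
  have hv : LipschitzWith (Kg * c) (fun s => g (γ s)) := hg.comp hγ
  have h0 : ∀ n, ∫ t in Icc (0 : ℝ) 1, f n (γ t) * deriv (fun s => g (γ s)) t = 0 := fun n => by
    have := hdeg (f n) g ⟨_, hfl n⟩ ⟨_, hg⟩
    rwa [intervalIntegral.integral_of_le zero_le_one, ← integral_Icc_eq_integral_Ioc] at this
  have hlim : Tendsto (fun n => ∫ t in Icc (0 : ℝ) 1, f n (γ t) * deriv (fun s => g (γ s)) t) atTop
      (𝓝 (∫ t in Icc (0 : ℝ) 1, K.indicator (deriv (fun s => g (γ s))) t)) := by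
    refine tendsto_integral_of_dominated_convergence (fun _ => (Kg * c : ℝ)) (fun n => ?_)
      (integrable_const _) (fun n => ?_) ?_
    · exact ((((hfl n).continuous.comp hγ.continuous).measurable).mul
        (measurable_deriv _)).aestronglyMeasurable
    · refine Eventually.of_forall fun t => ?_
      rw [norm_mul]
      have h1 : ‖f n (γ t)‖ ≤ 1 := by
        rw [hf, Real.norm_of_nonneg (NNReal.coe_nonneg _)]
        exact_mod_cast thickenedIndicator_le_one (hpos n) _ _
      have h2 : ‖deriv (fun s => g (γ s)) t‖ ≤ Kg * c := by
        simpa using norm_deriv_le_of_lipschitz (x₀ := t) hv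
      nlinarith [norm_nonneg (f n (γ t)), norm_nonneg (deriv (fun s => g (γ s)) t)]
    · refine (ae_restrict_iff' measurableSet_Icc).2 (Eventually.of_forall fun t ht => ?_)
      have h1 := tendsto_pi_nhds.1 (thickenedIndicator_tendsto_indicator_closure hpos
        tendsto_one_div_add_atTop_nhds_zero_nat (γ '' K)) (γ t)
      rw [hcl.closure_eq] at h1
      have h2 : Tendsto (fun n => f n (γ t)) atTop
          (𝓝 (((γ '' K).indicator (fun _ => (1 : ℝ≥0)) (γ t) : ℝ≥0) : ℝ)) :=
        (NNReal.continuous_coe.tendsto _).comp h1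
      have h3 := h2.mul_const (deriv (fun s => g (γ s)) t)
      convert h3 using 2
      by_cases htK : t ∈ K
      · simp [htK, mem_image_of_mem γ htK]
      · have : γ t ∉ γ '' K := by
          rintro ⟨s, hs, e⟩
          exact htK ((hKS hs).2 t ht e.symm ▸ hs)
        simp [htK, this]
  have h1 := tendsto_nhds_unique hlim (by simp only [h0]; exact tendsto_const_nhds)
  rw [setIntegral_indicator hK.measurableSet, inter_eq_right.2 (hKS.trans fun t ht => ht.1)] at h1
  exact h1

/-- Otherwise inner regularity gives a compact subset of positive measure, on which the integral of
a positive derivative would vanish. -/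
lemma DegreeZeroOn.volume_simpleTimes_deriv_pos {γ : ℝ → X} {c : ℝ≥0} (hγ : LipschitzWith c γ)
    (hdeg : DegreeZeroOn γ 1) {g : X → ℝ} {Kg : ℝ≥0} (hg : LipschitzWith Kg g) :
    volume (simpleTimes γ ∩ {t | 0 < deriv (fun s => g (γ s)) t}) = 0 := by
  by_contra hne
  obtain ⟨K, hKP, hK, hK0⟩ := ((measurableSet_simpleTimes hγ.continuous).inter
    (measurableSet_lt measurable_const (measurable_deriv _))).exists_lt_isCompact
      (pos_iff_ne_zero.2 hne)
  have h0 := hdeg.setIntegral_deriv_eq_zero hγ hg hK (hKP.trans inter_subset_left)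
  have hv : LipschitzWith (Kg * c) (fun s => g (γ s)) := hg.comp hγ
  have hint : IntegrableOn (deriv (fun s => g (γ s))) K := by
    refine Measure.integrableOn_of_bounded (M := Kg * c) hK.measure_lt_top.ne
      (measurable_deriv _).aestronglyMeasurable (Eventually.of_forall fun t => ?_)
    simpa using norm_deriv_le_of_lipschitz (x₀ := t) hv
  have := (setIntegral_pos_iff_support_of_nonneg_ae ((ae_restrict_iff' hK.measurableSet).2
    (Eventually.of_forall fun t ht => (hKP ht).2.le)) hint).2 (by
      have hs : K ⊆ Function.support (deriv fun s => g (γ s)) := fun t ht => (hKP ht).2.ne'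
      rwa [inter_eq_right.2 hs])
  exact this.ne' h0

lemma DegreeZeroOn.ae_deriv_eq_zero {γ : ℝ → X} {c : ℝ≥0} (hγ : LipschitzWith c γ)
    (hdeg : DegreeZeroOn γ 1) {g : X → ℝ} {Kg : ℝ≥0} (hg : LipschitzWith Kg g) :
    ∀ᵐ t, t ∈ simpleTimes γ → deriv (fun s => g (γ s)) t = 0 := by
  have h1 := hdeg.volume_simpleTimes_deriv_pos hγ hg
  have h2 := hdeg.volume_simpleTimes_deriv_pos hγ hg.neg
  filter_upwards [measure_eq_zero_iff_ae_notMem.1 h1, measure_eq_zero_iff_ae_notMem.1 h2]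
    with t ht1 ht2 htS
  have e : deriv (fun s => (-g) (γ s)) t = - deriv (fun s => g (γ s)) t := by
    simp [deriv.fun_neg]
  simp only [mem_inter_iff, htS, true_and, mem_ofPred_eq, not_lt, e] at ht1 ht2
  linarith

/-- On `S`, the map `f` factors through `φ` by a 1-Lipschitz map on `φ '' S`. -/
lemma hausdorffMeasure_image_le_of_edist_le {α Y Z : Type*} [EMetricSpace Y] [MeasurableSpace Y]
    [BorelSpace Y] [EMetricSpace Z] [MeasurableSpace Z] [BorelSpace Z] {f : α → Y} {φ : α → Z}
    {S : Set α} (h : ∀ s ∈ S, ∀ t ∈ S, edist (f s) (f t) ≤ edist (φ s) (φ t)) :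
    μH[1] (f '' S) ≤ μH[1] (φ '' S) := by
  rcases S.eq_empty_or_nonempty with rfl | ⟨a, _⟩
  · simp
  have : Nonempty α := ⟨a⟩
  have hr : ∀ s ∈ S, Function.invFunOn φ S (φ s) ∈ S ∧ φ (Function.invFunOn φ S (φ s)) = φ s :=
    fun s hs => Function.invFunOn_pos ⟨s, hs, rfl⟩
  have hβ : LipschitzOnWith 1 (fun z => f (Function.invFunOn φ S z)) (φ '' S) := by
    rintro _ ⟨s, hs, rfl⟩ _ ⟨t, ht, rfl⟩
    have := h _ (hr s hs).1 _ (hr t ht).1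
    rw [(hr s hs).2, (hr t ht).2] at this
    simpa using this
  have him : f '' S = (fun z => f (Function.invFunOn φ S z)) '' (φ '' S) := by
    rw [image_image]
    refine image_congr fun s hs => ?_
    have := h _ (hr s hs).1 _ hs
    rw [(hr s hs).2, edist_self, nonpos_iff_eq_zero, edist_eq_zero] at this
    exact this.symm
  rw [him]
  simpa using hβ.hausdorffMeasure_image_le zero_le_one

/-- A Lipschitz path of degree zero attains almost none of its values exactly once. -/
theorem DegreeZeroOn.hausdorffMeasure_image_simpleTimes [MeasurableSpace X] [BorelSpace X]
    {γ : ℝ → X} {c : ℝ≥0} (hγ : LipschitzWith c γ) (hdeg : DegreeZeroOn γ 1) :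
    μH[1] (γ '' simpleTimes γ) = 0 := by
  set S := simpleTimes γ with hS
  have hSm : MeasurableSet S := measurableSet_simpleTimes hγ.continuous
  -- The density `k` bounds the speed of `γ` and vanishes on `S`. Its primitive `φ` dominates
  -- distances along `γ`, which reduces the claim to `φ '' S` being null in `ℝ`.
  set k : ℝ → ℝ := Sᶜ.indicator (fun _ => (c : ℝ)) with hk
  have hk0 : ∀ t, 0 ≤ k t := fun t => indicator_nonneg (fun _ _ => c.2) t
  have hkc : ∀ t, k t ≤ c := fun t => indicator_le_self' (fun _ _ => c.2) t
  have hkm : Measurable k := measurable_const.indicator hSm.compl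
  have hki : LocallyIntegrable k := by
    refine (locallyIntegrable_const (c : ℝ)).mono hkm.aestronglyMeasurable
      (Eventually.of_forall fun t => ?_)
    rw [Real.norm_of_nonneg (hk0 t)]
    exact (hkc t).trans (le_abs_self _)
  have hkii : ∀ a b, IntervalIntegrable k volume a b := fun a b =>
    (hki.integrableOn_isCompact isCompact_uIcc).intervalIntegrable
  set φ : ℝ → ℝ := fun x => ∫ t in (0 : ℝ)..x, k t with hφ
  have hφsub : ∀ s t, φ t - φ s = ∫ u in s..t, k u := fun s t =>
    intervalIntegral.integral_interval_sub_left (hkii _ _) (hkii _ _)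
  have hφl : LipschitzWith c φ := by
    refine LipschitzWith.of_dist_le_mul fun x y => ?_
    rw [Real.dist_eq, Real.dist_eq, hφsub, ← Real.norm_eq_abs]
    refine intervalIntegral.norm_integral_le_of_norm_le_const (f := k) fun t _ => ?_
    rw [Real.norm_of_nonneg (hk0 t)]
    exact hkc t
  have hle : ∀ s t, s ≤ t → dist (γ s) (γ t) ≤ φ t - φ s := by
    intro s t hst
    -- A metric space has no velocity, so the distance to `γ s` serves as test function `g`.
    have hg : LipschitzWith 1 (fun x => dist (γ s) x) := LipschitzWith.dist_right _
    have hv : LipschitzWith (1 * c) (fun u => dist (γ s) (γ u)) := hg.comp hγ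
    have e := (hv.absolutelyContinuousOnInterval s t).integral_deriv_eq_sub
    rw [dist_self, sub_zero] at e
    rw [hφsub, ← e]
    refine intervalIntegral.integral_mono_ae hst (hv.intervalIntegrable_deriv s t) (hkii s t) ?_
    filter_upwards [hdeg.ae_deriv_eq_zero hγ hg] with u hu
    by_cases huS : u ∈ S
    · rw [hu huS]
      exact hk0 u
    · rw [hk, indicator_of_mem (show u ∈ Sᶜ from huS)]
      simpa using (le_abs_self _).trans (norm_deriv_le_of_lipschitz (x₀ := u) hv)
  have hle' : ∀ s t, edist (γ s) (γ t) ≤ edist (φ s) (φ t) := by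
    intro s t
    rw [edist_dist, edist_dist]
    refine ENNReal.ofReal_le_ofReal ?_
    rcases le_total s t with h | h
    · refine (hle s t h).trans ?_
      rw [dist_comm]
      exact le_abs_self _
    · rw [dist_comm]
      exact (hle t s h).trans (le_abs_self _)
  have hnull : volume (φ '' S) = 0 := by
    -- By Lebesgue differentiation `φ' = k = 0` a.e. on `S`. The image of the points where `φ' = 0`
    -- is null by Sard's lemma, and the exceptional null set has null image because `φ` is
    -- Lipschitz.
    have hd := LocallyIntegrable.ae_hasDerivAt_integral hki
    have h1 : volume (φ '' (S ∩ {t | HasDerivAt φ 0 t})) = 0 := by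
      refine addHaar_image_eq_zero_of_det_fderivWithin_eq_zero volume
        (f' := fun _ => 0) (fun t ht => ?_) (fun t _ => by simp)
      simpa using (ht.2.hasFDerivAt.hasFDerivWithinAt (s := S ∩ {t | HasDerivAt φ 0 t}))
    have h2 : volume (φ '' (S \ {t | HasDerivAt φ 0 t})) = 0 := by
      have h3 : volume (S \ {t | HasDerivAt φ 0 t}) = 0 := by
        rw [measure_eq_zero_iff_ae_notMem]
        filter_upwards [hd] with t ht htS
        refine htS.2 ?_
        have := ht 0
        rwa [hk, indicator_of_notMem (by simpa using htS.1)] at this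
      have := hφl.hausdorffMeasure_image_le zero_le_one (S \ {t | HasDerivAt φ 0 t})
      rw [hausdorffMeasure_real, h3, mul_zero] at this
      exact nonpos_iff_eq_zero.1 this
    rw [← inter_union_sdiff S {t | HasDerivAt φ 0 t}, image_union]
    exact measure_union_null h1 h2
  have := hausdorffMeasure_image_le_of_edist_le (S := S) fun s _ t _ => hle' s t
  rw [hausdorffMeasure_real, hnull] at this
  exact nonpos_iff_eq_zero.1 this

end degreeZero

/-! ### Length, Hausdorff measure and multiplicity. -/

section length

variable {X : Type*} [MetricSpace X] [MeasurableSpace X] [BorelSpace X]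

/-- A ball centred in a connected set which does not contain the set meets it in a set of length
at least its radius. -/
lemma IsPreconnected.ofReal_le_hausdorffMeasure_inter_ball {C : Set X} (hC : IsPreconnected C)
    {x y : X} (hx : x ∈ C) (hy : y ∈ C) {r : ℝ} (hr : r ≤ dist y x) :
    ENNReal.ofReal r ≤ μH[1] (C ∩ Metric.ball x r) := by
  have hf : LipschitzWith 1 (fun z => dist z x) := LipschitzWith.dist_left x
  have hsub : Ico 0 r ⊆ (fun z => dist z x) '' (C ∩ Metric.ball x r) := by
    intro t ht
    have hp := hC.image _ hf.continuous.continuousOn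
    obtain ⟨z, hz, rfl⟩ := hp.ordConnected.out (mem_image_of_mem _ hx) (mem_image_of_mem _ hy)
      (show t ∈ Icc (dist x x) (dist y x) from ⟨by simpa using ht.1, ht.2.le.trans hr⟩)
    exact ⟨z, ⟨hz, ht.2⟩, rfl⟩
  calc ENNReal.ofReal r = volume (Ico 0 r) := by simp
    _ ≤ μH[1] ((fun z => dist z x) '' (C ∩ Metric.ball x r)) := by
        rw [hausdorffMeasure_real]
        exact measure_mono hsub
    _ ≤ μH[1] (C ∩ Metric.ball x r) := by
        simpa using hf.hausdorffMeasure_image_le zero_le_one (C ∩ Metric.ball x r)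

lemma IsPreconnected.edist_le_hausdorffMeasure {C : Set X} (hC : IsPreconnected C)
    {x y : X} (hx : x ∈ C) (hy : y ∈ C) : edist x y ≤ μH[1] C := by
  rw [edist_comm, edist_dist]
  exact (hC.ofReal_le_hausdorffMeasure_inter_ball hx hy le_rfl).trans
    (measure_mono inter_subset_left)

/-- The images of `n + 1` equal subintervals cover the trace with vanishing diameters, each diameter
being at most the variation on its subinterval. -/
lemma hausdorffMeasure_image_Icc_le_eVariationOn {γ : ℝ → X} {c : ℝ≥0} (hγ : LipschitzWith c γ)
    {a b : ℝ} (hab : a ≤ b) : μH[1] (γ '' Icc a b) ≤ eVariationOn γ (Icc a b) := by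
  set p : ℕ → ℕ → ℝ := fun n j => a + j * ((b - a) / (n + 1)) with hp
  have hd : ∀ n : ℕ, 0 ≤ (b - a) / ((n : ℝ) + 1) := fun n =>
    div_nonneg (sub_nonneg.2 hab) (by positivity)
  have hImono : ∀ n, Monotone (p n) := fun n i j hij => by
    have : (i : ℝ) ≤ j := by exact_mod_cast hij
    simp only [hp]
    nlinarith [mul_le_mul_of_nonneg_right this (hd n)]
  have hI0 : ∀ n, p n 0 = a := fun n => by simp [hp]
  have hIn : ∀ n, p n (n + 1) = b := fun n => by
    simp only [hp]
    push_cast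
    field_simp
    ring
  have hr : Tendsto (fun n : ℕ => ENNReal.ofReal (c * ((b - a) / ((n : ℝ) + 1)))) atTop (𝓝 0) := by
    rw [← ENNReal.ofReal_zero]
    refine (ENNReal.continuous_ofReal.tendsto 0).comp ?_
    have := (tendsto_one_div_add_atTop_nhds_zero_nat (𝕜 := ℝ)).const_mul (c * (b - a))
    rw [mul_zero] at this
    exact this.congr fun n => by ring
  have key := Measure.hausdorffMeasure_le_liminf_sum (ι := fun n => Fin (n + 1)) 1 (γ '' Icc a b)
    (l := atTop) _ hr (fun n (j : Fin (n + 1)) => γ '' Icc (p n j) (p n (j + 1)))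
    (Eventually.of_forall fun n j => ?_) (Eventually.of_forall fun n => ?_)
  · refine key.trans ((liminf_le_liminf (Eventually.of_forall fun n =>
      (?_ : _ ≤ eVariationOn γ (Icc a b)))).trans (liminf_const _).le)
    calc ∑ j : Fin (n + 1), Metric.ediam (γ '' Icc (p n j) (p n (j + 1))) ^ (1 : ℝ)
        ≤ ∑ j : Fin (n + 1), eVariationOn γ (Icc (p n j) (p n (j + 1))) := by
          refine Finset.sum_le_sum fun j _ => ?_
          rw [ENNReal.rpow_one]
          refine Metric.ediam_le ?_
          rintro _ ⟨s, hs, rfl⟩ _ ⟨t, ht, rfl⟩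
          exact eVariationOn.edist_le γ hs ht
      _ = ∑ j ∈ Finset.range (n + 1), eVariationOn γ (Icc (p n j) (p n (j + 1))) :=
          Fin.sum_univ_eq_sum_range (fun j => eVariationOn γ (Icc (p n j) (p n (j + 1)))) (n + 1)
      _ ≤ eVariationOn γ (Icc a b) := by rw [eVariationOn.sum' γ (hImono n), hI0, hIn]
  · refine Metric.ediam_le ?_
    rintro _ ⟨s, hs, rfl⟩ _ ⟨t, ht, rfl⟩
    rw [edist_dist]
    refine ENNReal.ofReal_le_ofReal ((hγ.dist_le_mul s t).trans
      (mul_le_mul_of_nonneg_left ?_ c.2))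
    have := Real.dist_le_of_mem_Icc hs ht
    have e : p n (j + 1) - p n j = (b - a) / (n + 1) := by
      simp only [hp]
      push_cast
      ring
    rwa [e] at this
  · rintro _ ⟨t, ht, rfl⟩
    have h : Icc (p n 0) (p n (n + 1)) ⊆ ⋃ i < n + 1, Icc (p n i) (p n (i + 1)) := by
      suffices ∀ m, Icc (p n 0) (p n (m + 1)) ⊆ ⋃ i < m + 1, Icc (p n i) (p n (i + 1)) from this n
      intro m
      induction m with
      | zero => exact fun u hu => mem_iUnion₂.2 ⟨0, by simp, hu⟩
      | succ m ih =>
        intro u hu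
        rcases le_total u (p n (m + 1)) with hum | hum
        · obtain ⟨i, hi, hui⟩ := mem_iUnion₂.1 (ih ⟨hu.1, hum⟩)
          exact mem_iUnion₂.2 ⟨i, hi.trans (Nat.lt_succ_self _), hui⟩
        · exact mem_iUnion₂.2 ⟨m + 1, Nat.lt_succ_self _, hum, hu.2⟩
    rw [hI0, hIn] at h
    obtain ⟨i, hi, hti⟩ := mem_iUnion₂.1 (h ht)
    exact mem_iUnion.2 ⟨⟨i, hi⟩, t, hti, rfl⟩

/-- Number of the intervals `[j / n, (j + 1) / n]`, `j < n`, whose image contains `x`. -/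
noncomputable def gridMultiplicity {X : Type*} (γ : ℝ → X) (n : ℕ) (x : X) : ℝ≥0∞ :=
  ∑ j ∈ Finset.range n, (γ '' Icc ((j : ℝ) / n) ((j + 1 : ℕ) / n)).indicator (fun _ => 1) x

/-- The asymptotic number of short intervals in `[0, 1]` whose image contains `x`. -/
noncomputable def limMultiplicity {X : Type*} (γ : ℝ → X) (x : X) : ℝ≥0∞ :=
  liminf (fun n => gridMultiplicity γ n x) atTop

lemma measurable_gridMultiplicity {γ : ℝ → X} (hγ : Continuous γ) (n : ℕ) :
    Measurable (gridMultiplicity γ n) :=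
  Finset.measurable_fun_sum _ fun _ _ =>
    measurable_const.indicator (isCompact_Icc.image hγ).measurableSet

lemma measurable_limMultiplicity {γ : ℝ → X} (hγ : Continuous γ) :
    Measurable (limMultiplicity γ) :=
  Measurable.liminf fun n => measurable_gridMultiplicity hγ n

/-- Fatou's lemma: each grid multiplicity with `n > 0` integrates to the sum of the measures of the
pieces, which is at most the length. -/
lemma lintegral_limMultiplicity_le {γ : ℝ → X} {c : ℝ≥0} (hγ : LipschitzWith c γ) :
    ∫⁻ x, limMultiplicity γ x ∂μH[1] ≤ eVariationOn γ (Icc 0 1) := by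
  refine (lintegral_liminf_le fun n => measurable_gridMultiplicity hγ.continuous n).trans ?_
  refine (liminf_le_liminf ?_).trans (liminf_const (f := atTop) _).le
  filter_upwards [eventually_gt_atTop 0] with n hn
  have hn' : (0 : ℝ) < n := by exact_mod_cast hn
  have hmono : Monotone fun j : ℕ => (j : ℝ) / n := fun i j hij =>
    div_le_div_of_nonneg_right (by exact_mod_cast hij) hn'.le
  simp only [gridMultiplicity]
  rw [lintegral_finsetSum _ fun _ _ =>
    measurable_const.indicator (isCompact_Icc.image hγ.continuous).measurableSet]
  calc ∑ j ∈ Finset.range n, ∫⁻ x, (γ '' Icc ((j : ℝ) / n) ((j + 1 : ℕ) / n)).indicator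
        (fun _ => 1) x ∂μH[1]
      ≤ ∑ j ∈ Finset.range n, eVariationOn γ (Icc ((j : ℝ) / n) ((j + 1 : ℕ) / n)) := by
        refine Finset.sum_le_sum fun j _ => ?_
        rw [lintegral_indicator_const (isCompact_Icc.image hγ.continuous).measurableSet, one_mul]
        exact hausdorffMeasure_image_Icc_le_eVariationOn hγ (hmono (Nat.le_succ j))
    _ = eVariationOn γ (Icc 0 1) := by
        rw [eVariationOn.sum' γ hmono]
        simp [hn'.ne']

/-- Once `1 / n` is smaller than all gaps in `F`, different times of `F` lie in different grid
cells, and each of these cells counts. -/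
lemma card_le_limMultiplicity {X : Type*} {γ : ℝ → X} {x : X} {F : Finset ℝ} (hF : ∀ t ∈ F, t ∈ Icc (0 : ℝ) 1)
    (hx : ∀ t ∈ F, γ t = x) : (F.card : ℝ≥0∞) ≤ limMultiplicity γ x := by
  refine le_liminf_of_le (by isBoundedDefault) ?_
  have hsep : ∀ᶠ n : ℕ in atTop, ∀ t ∈ F, ∀ s ∈ F, t ≠ s → (1 : ℝ) / n < |t - s| := by
    rw [Filter.eventually_all_finset]
    intro t _
    rw [Filter.eventually_all_finset]
    intro s _
    by_cases hts : t = s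
    · simp [hts]
    · filter_upwards [(tendsto_one_div_atTop_nhds_zero_nat (𝕜 := ℝ)).eventually_lt_const
        (abs_pos.2 (sub_ne_zero.2 hts))] with n hn _ using hn
  filter_upwards [hsep, eventually_gt_atTop 0] with n hn hn0
  have hn' : (0 : ℝ) < n := by exact_mod_cast hn0
  have hj : ∀ t ∈ F, ∃ j ∈ Finset.range n, t ∈ Icc ((j : ℝ) / n) ((j + 1 : ℕ) / n) := by
    intro t ht
    obtain ⟨h0, h1⟩ := hF t ht
    rcases h1.lt_or_eq with h1 | rfl
    · refine ⟨⌊t * n⌋₊, ?_, ?_, ?_⟩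
      · rw [Finset.mem_range, Nat.floor_lt (by positivity)]
        nlinarith
      · rw [div_le_iff₀ hn']
        exact Nat.floor_le (by positivity)
      · rw [le_div_iff₀ hn']
        push_cast
        exact (Nat.lt_floor_add_one _).le
    -- The floor would give the cell of index `n`, outside the grid, so the time `1` goes to the
    -- last cell.
    · refine ⟨n - 1, by simp [hn0], ?_, ?_⟩
      · rw [div_le_one hn']
        exact_mod_cast Nat.sub_le n 1
      · rw [Nat.sub_add_cancel hn0, div_self hn'.ne']
  choose! j hjn hjt using hj
  have hinj : Set.InjOn j F := by
    intro t ht s hs e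
    by_contra hne
    have h1 := hjt t ht
    rw [e] at h1
    have h2 := Real.dist_le_of_mem_Icc h1 (hjt s hs)
    have e2 : (((j s + 1 : ℕ) : ℝ) / n) - (j s : ℝ) / n = 1 / n := by
      push_cast
      ring
    rw [e2, Real.dist_eq] at h2
    exact (hn t ht s hs hne).not_ge h2
  calc (F.card : ℝ≥0∞) = ∑ i ∈ F.image j, 1 := by
        rw [Finset.sum_const, Finset.card_image_of_injOn hinj, nsmul_one]
    _ = ∑ i ∈ F.image j, (γ '' Icc ((i : ℝ) / n) ((i + 1 : ℕ) / n)).indicator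
          (fun _ => (1 : ℝ≥0∞)) x := by
        refine Finset.sum_congr rfl fun i hi => ?_
        obtain ⟨t, ht, rfl⟩ := Finset.mem_image.1 hi
        rw [indicator_of_mem]
        exact ⟨t, hjt t ht, hx t ht⟩
    _ ≤ gridMultiplicity γ n x := by
        refine Finset.sum_le_sum_of_subset fun i hi => ?_
        obtain ⟨t, ht, rfl⟩ := Finset.mem_image.1 hi
        exact hjn t ht

/-- For a Lipschitz path of degree zero, a.e. point of the image is attained at least twice. -/
lemma DegreeZeroOn.ae_two_preimages {γ : ℝ → X} {c : ℝ≥0} (hγ : LipschitzWith c γ)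
    (hdeg : DegreeZeroOn γ 1) :
    ∀ᵐ x ∂(μH[1] : Measure X), x ∈ γ '' Icc 0 1 →
      ∃ t ∈ Icc (0 : ℝ) 1, ∃ s ∈ Icc (0 : ℝ) 1, t ≠ s ∧ γ t = x ∧ γ s = x := by
  filter_upwards [measure_eq_zero_iff_ae_notMem.1 (hdeg.hausdorffMeasure_image_simpleTimes hγ)]
  rintro _ hx ⟨t, ht, rfl⟩
  by_contra hcon
  refine hx ⟨t, ⟨ht, fun s hs e => ?_⟩, rfl⟩
  by_contra hne
  exact hcon ⟨t, ht, s, hs, Ne.symm hne, rfl, e⟩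

lemma DegreeZeroOn.ae_two_le_limMultiplicity {γ : ℝ → X} {c : ℝ≥0} (hγ : LipschitzWith c γ)
    (hdeg : DegreeZeroOn γ 1) :
    ∀ᵐ x ∂(μH[1] : Measure X), x ∈ γ '' Icc 0 1 → 2 ≤ limMultiplicity γ x := by
  filter_upwards [hdeg.ae_two_preimages hγ] with x hx hmem
  obtain ⟨t, ht, s, hs, hne, et, es⟩ := hx hmem
  have := card_le_limMultiplicity (γ := γ) (x := x) (F := {t, s})
    (by simp only [Finset.mem_insert, Finset.mem_singleton]; rintro u (rfl | rfl) <;> assumption)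
    (by simp only [Finset.mem_insert, Finset.mem_singleton]; rintro u (rfl | rfl) <;> assumption)
  rw [Finset.card_pair hne] at this
  exact_mod_cast this

/-- The image of a Lipschitz path of degree zero has at most half the length of the path. -/
theorem DegreeZeroOn.two_mul_hausdorffMeasure_image_le {γ : ℝ → X} {c : ℝ≥0}
    (hγ : LipschitzWith c γ) (hdeg : DegreeZeroOn γ 1) :
    2 * μH[1] (γ '' Icc 0 1) ≤ eVariationOn γ (Icc 0 1) := by
  have hm : MeasurableSet (γ '' Icc 0 1) := (isCompact_Icc.image hγ.continuous).measurableSet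
  calc 2 * μH[1] (γ '' Icc 0 1) = ∫⁻ x in γ '' Icc 0 1, 2 ∂μH[1] := by
        rw [setLIntegral_const]
    _ ≤ ∫⁻ x in γ '' Icc 0 1, limMultiplicity γ x ∂μH[1] :=
        lintegral_mono_ae ((ae_restrict_iff' hm).2 (hdeg.ae_two_le_limMultiplicity hγ))
    _ ≤ ∫⁻ x, limMultiplicity γ x ∂μH[1] := setLIntegral_le_lintegral _ _
    _ ≤ eVariationOn γ (Icc 0 1) := lintegral_limMultiplicity_le hγ

lemma LipschitzWith.eVariationOn_Icc_le {Y : Type*} [PseudoMetricSpace Y] {γ : ℝ → Y} {c : ℝ≥0}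
    (hγ : LipschitzWith c γ) (a b : ℝ) :
    eVariationOn γ (Icc a b) ≤ c * ENNReal.ofReal (b - a) := by
  have := hγ.lipschitzOnWith (s := univ) |>.comp_eVariationOn_le (f := γ) (g := id)
    (s := Icc a b) (mapsTo_univ _ _)
  rwa [eVariationOn_id_Icc] at this

end length

/-! ### Ultralimits of paths, discrete chains and shortest paths. -/

section ultralimit

variable {X : Type*} [MetricSpace X]

/-- Almost equi-Lipschitz maps which approach a compact set converge pointwise along any
ultrafilter. -/
lemma exists_lipschitzWith_ultralimit {ι : Type*} (U : Ultrafilter ι) {K : Set X}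
    (hK : IsCompact K) {F : ι → ℝ → X}
    (hFK : ∀ t, ∃ k : ι → X, (∀ i, k i ∈ K) ∧ Tendsto (fun i => dist (k i) (F i t)) U (𝓝 0))
    {c : ℝ≥0} {e : ι → ℝ} (he : Tendsto e U (𝓝 0))
    (hF : ∀ᶠ i in (U : Filter ι), ∀ s t, dist (F i s) (F i t) ≤ c * dist s t + e i) :
    ∃ γ : ℝ → X, LipschitzWith c γ ∧ (∀ t, γ t ∈ K) ∧
      ∀ t, Tendsto (fun i => F i t) U (𝓝 (γ t)) := by
  have h : ∀ t, ∃ x ∈ K, Tendsto (fun i => F i t) U (𝓝 x) := by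
    intro t
    obtain ⟨k, hkK, hk⟩ := hFK t
    obtain ⟨x, hx, hUx⟩ := hK.ultrafilter_le_nhds' (U.map k)
      (Ultrafilter.mem_map.2 (univ_mem' hkK))
    have : Tendsto k U (𝓝 x) := hUx
    exact ⟨x, hx, (tendsto_iff_of_dist hk).1 this⟩
  choose γ hγK hγ using h
  refine ⟨γ, LipschitzWith.of_dist_le_mul fun s t => ?_, hγK, hγ⟩
  have := le_of_tendsto_of_tendsto ((hγ s).dist (hγ t)) (he.const_add (c * dist s t)) (hF.mono
    fun i hi => hi s t)
  simpa using this

lemma tendstoUniformlyOn_of_lipschitzWith {ι : Type*} {U : Filter ι} {F : ι → ℝ → X} {γ : ℝ → X}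
    {c : ℝ≥0} (hF : ∀ᶠ i in U, LipschitzWith c (F i)) (hγ : LipschitzWith c γ)
    (hlim : ∀ t, Tendsto (fun i => F i t) U (𝓝 (γ t))) {S : Set ℝ} (hS : IsCompact S) :
    TendstoUniformlyOn F γ U S := by
  rw [Metric.tendstoUniformlyOn_iff]
  intro ε hε
  have hδ : 0 < ε / (3 * (c + 1)) := by positivity
  obtain ⟨T, -, hT, hcov⟩ := hS.finite_cover_balls hδ
  have hev : ∀ᶠ i in U, ∀ t ∈ T, dist (F i t) (γ t) < ε / 3 :=
    (Filter.eventually_all_finite hT).2 fun t _ =>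
      Metric.tendsto_nhds.1 (hlim t) _ (by positivity)
  filter_upwards [hev, hF] with i hi hLi t ht
  obtain ⟨s, hs, hts⟩ := mem_iUnion₂.1 (hcov ht)
  rw [Metric.mem_ball] at hts
  have hc : c * dist t s ≤ ε / 3 := by
    have h1 : c * dist t s ≤ (c + 1) * (ε / (3 * (c + 1))) := by
      have := c.2
      gcongr
      linarith
    have h2 : (c + 1) * (ε / (3 * (c + 1))) = ε / 3 := by
      field_simp
    linarith
  have h1 := hγ.dist_le_mul t s
  have h2 := hLi.dist_le_mul s t
  have h3 := dist_triangle4 (γ t) (γ s) (F i s) (F i t)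
  have h4 := hi s hs
  rw [dist_comm] at h4
  rw [dist_comm s t] at h2
  linarith

lemma mem_image_of_tendstoUniformlyOn {ι : Type*} {U : Filter ι} [U.NeBot] {F : ι → ℝ → X}
    {γ : ℝ → X} (hγ : Continuous γ) {S : Set ℝ} (hS : IsCompact S)
    (hlim : TendstoUniformlyOn F γ U S) {x : X}
    (hx : ∀ ε > 0, ∀ᶠ i in U, ∃ t ∈ S, dist x (F i t) < ε) : x ∈ γ '' S := by
  rw [← (hS.image hγ).isClosed.closure_eq, Metric.mem_closure_iff]
  intro ε hε
  obtain ⟨i, hi, t, ht, hxt⟩ := ((Metric.tendstoUniformlyOn_iff.1 hlim (ε / 2) (by positivity)).and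
    (hx (ε / 2) (by positivity))).exists
  refine ⟨γ t, mem_image_of_mem _ ht, ?_⟩
  have := hi t ht
  rw [dist_comm] at this
  linarith [dist_triangle x (F i t) (γ t)]

lemma LipschitzWith.ite_le {c : ℝ≥0} {f g : ℝ → X} (hf : LipschitzWith c f)
    (hg : LipschitzWith c g) {a : ℝ} (h : f a = g a) :
    LipschitzWith c (fun t => if t ≤ a then f t else g t) := by
  have key : ∀ s t, s ≤ t → dist (if s ≤ a then f s else g s) (if t ≤ a then f t else g t) ≤
      c * dist s t := by
    intro s t hst
    by_cases hs : s ≤ a <;> by_cases ht : t ≤ a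
    · simpa [hs, ht] using hf.dist_le_mul s t
    · simp only [hs, ht, if_true, if_false]
      have h1 := hf.dist_le_mul s a
      have h2 := hg.dist_le_mul a t
      have h3 := dist_triangle (f s) (f a) (g t)
      rw [h] at h1 h3
      have h4 : dist s a + dist a t = dist s t := by
        rw [dist_comm s a, dist_comm s t, dist_comm a t, Real.dist_eq, Real.dist_eq, Real.dist_eq,
          abs_of_nonneg, abs_of_nonneg, abs_of_nonneg] <;> linarith
      rw [← h4, mul_add]
      linarith
    · exact absurd (hst.trans ht) hs
    · simpa [hs, ht] using hg.dist_le_mul s t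
  refine LipschitzWith.of_dist_le_mul fun s t => ?_
  rcases le_total s t with h | h
  · exact key s t h
  · rw [dist_comm, dist_comm s t]
    exact key t s h

/-- The chain is a geodesic in the graph joining points at distance less than `ε`. This graph is
connected because the points reachable from `q` form a clopen set, and vertices of a geodesic two or
more steps apart are not adjacent. -/
lemma exists_graph_chain [ConnectedSpace X] {ε : ℝ} (hε : 0 < ε) (q p : X) :
    ∃ N : ℕ, ∃ x : ℕ → X, x 0 = q ∧ x N = p ∧ (∀ i, dist (x i) (x (i + 1)) ≤ ε) ∧
      ∀ i j, i + 2 ≤ j → j ≤ N → ε ≤ dist (x i) (x j) := by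
  set G : SimpleGraph X := SimpleGraph.fromRel fun x y => dist x y < ε with hG
  have hadj : ∀ x y, dist x y < ε → x = y ∨ G.Adj x y := fun x y h => by
    by_cases hxy : x = y
    · exact Or.inl hxy
    · exact Or.inr ((SimpleGraph.fromRel_adj _ _ _).2 ⟨hxy, Or.inl h⟩)
  have hreach : ∀ x y, dist x y < ε → G.Reachable x y := fun x y h => by
    rcases hadj x y h with rfl | h
    · exact SimpleGraph.Reachable.refl _
    · exact h.reachable
  have hclopen : IsClopen {y | G.Reachable q y} := by
    constructor
    · rw [← isOpen_compl_iff, Metric.isOpen_iff]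
      intro y hy
      refine ⟨ε, hε, fun z hz hqz => hy ?_⟩
      exact SimpleGraph.Reachable.trans hqz (hreach z y hz)
    · rw [Metric.isOpen_iff]
      intro y hy
      refine ⟨ε, hε, fun z hz => ?_⟩
      exact SimpleGraph.Reachable.trans hy (hreach y z (by rwa [dist_comm]))
  have huniv := hclopen.eq_univ ⟨q, SimpleGraph.Reachable.refl _⟩
  have hall : ∀ y, G.Reachable q y := fun y => (huniv ▸ mem_univ y : y ∈ {y | G.Reachable q y})
  have hconn : G.Connected :=
    { preconnected := fun x y => (hall x).symm.trans (hall y)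
      nonempty := ⟨q⟩ }
  obtain ⟨w, hw⟩ := (hall p).exists_walk_length_eq_dist
  have hdist : ∀ i ≤ w.length, G.dist q (w.getVert i) = i := by
    intro i hi
    have h1 : G.dist q (w.getVert i) ≤ i := by
      have := SimpleGraph.dist_le (w.take i)
      rwa [SimpleGraph.Walk.take_length, min_eq_left hi] at this
    have h2 : G.dist (w.getVert i) p ≤ w.length - i := by
      have := SimpleGraph.dist_le (w.drop i)
      rwa [SimpleGraph.Walk.drop_length] at this
    have h3 := hconn.dist_triangle (u := q) (v := w.getVert i) (w := p)
    omega
  refine ⟨w.length, w.getVert, w.getVert_zero, w.getVert_length, fun i => ?_, fun i j hij hj => ?_⟩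
  · rcases lt_or_ge i w.length with hi | hi
    · have := (SimpleGraph.fromRel_adj _ _ _).1 (w.adj_getVert_succ hi)
      rcases this.2 with h | h
      · exact h.le
      · rw [dist_comm]
        exact h.le
    -- Beyond its length the walk stays at its last vertex.
    · rw [w.getVert_of_length_le hi, w.getVert_of_length_le (hi.trans (Nat.le_succ i)), dist_self]
      exact hε.le
  · by_contra hlt
    have h1 := hdist i (by omega)
    have h2 := hdist j hj
    rcases hadj _ _ (not_le.1 hlt) with h | h
    · rw [h] at h1
      omega
    · have h3 := hconn.dist_triangle (u := q) (v := w.getVert i) (w := w.getVert j)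
      rw [SimpleGraph.dist_eq_one_iff_adj.2 h] at h3
      omega

lemma dist_chain_le {x : ℕ → X} {ε : ℝ} (hstep : ∀ i, dist (x i) (x (i + 1)) ≤ ε) (i j : ℕ) :
    dist (x i) (x j) ≤ ε * |(i : ℝ) - j| := by
  wlog hij : i ≤ j
  · rw [dist_comm, abs_sub_comm]
    exact this hstep j i (le_of_not_ge hij)
  have := dist_le_Ico_sum_of_dist_le (f := x) hij (d := fun _ => ε) fun _ _ => hstep _
  rw [Finset.sum_const, Nat.card_Ico, nsmul_eq_mul, Nat.cast_sub hij] at this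
  rw [abs_sub_comm, abs_of_nonneg (sub_nonneg.2 (by exact_mod_cast hij)), mul_comm]
  exact this

/-- Lengths of paths, parametrized with speed at most one, which start from `q` and end in `K`. -/
def pathTimesTo {X : Type*} [MetricSpace X] (q : X) (K : Set X) : Set ℝ :=
  {ℓ | 0 ≤ ℓ ∧ ∃ ρ : ℝ → X, LipschitzWith 1 ρ ∧ ρ 0 = q ∧ ρ ℓ ∈ K}

/-- An ultralimit of a minimizing sequence of 1-Lipschitz paths is again a competitor. -/
lemma exists_isLeast_pathTimesTo [CompactSpace X] {q : X} {K : Set X} (hK : IsClosed K)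
    (hne : (pathTimesTo q K).Nonempty) : ∃ ℓ, IsLeast (pathTimesTo q K) ℓ := by
  have hbdd : BddBelow (pathTimesTo q K) := ⟨0, fun _ h => h.1⟩
  refine ⟨sInf (pathTimesTo q K), ?_, fun _ h => csInf_le hbdd h⟩
  obtain ⟨u, -, hu, hmem⟩ := exists_seq_tendsto_sInf hne hbdd
  choose hu0 ρ hρ hρ0 hρK using hmem
  have hU : ((hyperfilter ℕ : Ultrafilter ℕ) : Filter ℕ) ≤ atTop := by
    rw [← Nat.cofinite_eq_atTop]
    exact hyperfilter_le_cofinite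
  obtain ⟨γ, hγ, -, hlim⟩ := exists_lipschitzWith_ultralimit (hyperfilter ℕ) isCompact_univ
    (F := ρ) (c := 1) (e := fun _ => 0) (fun t => ⟨fun n => ρ n t, fun _ => mem_univ _, by simp⟩)
    tendsto_const_nhds (Eventually.of_forall fun n s t => by simpa using (hρ n).dist_le_mul s t)
  refine ⟨Real.sInf_nonneg fun _ h => h.1, γ, hγ, tendsto_nhds_unique (hlim 0) (by simp [hρ0]), ?_⟩
  refine hK.mem_of_tendsto (b := (hyperfilter ℕ : Filter ℕ)) (f := fun n => ρ n (u n)) ?_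
    (Eventually.of_forall hρK)
  refine (tendsto_iff_of_dist ?_).1 (hlim _)
  have h0 : Tendsto (fun n => dist (sInf (pathTimesTo q K)) (u n)) (hyperfilter ℕ) (𝓝 0) := by
    have := (tendsto_const_nhds (x := sInf (pathTimesTo q K))).dist (hu.mono_left hU)
    rwa [dist_self] at this
  exact squeeze_zero (fun _ => dist_nonneg) (fun n => by simpa using (hρ n).dist_le_mul _ _) h0

/-- If `ρ a = ρ b` with `a < b`, cutting out the loop on `[a, b]` gives a competitor of duration `ℓ
- (b - a)`. -/
lemma injOn_of_isLeast_pathTimesTo {q : X} {K : Set X} {ℓ : ℝ}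
    (hℓ : IsLeast (pathTimesTo q K) ℓ) {ρ : ℝ → X} (hρ : LipschitzWith 1 ρ) (h0 : ρ 0 = q)
    (hK : ρ ℓ ∈ K) : InjOn ρ (Icc 0 ℓ) := by
  have key : ∀ a ∈ Icc 0 ℓ, ∀ b ∈ Icc 0 ℓ, a < b → ρ a ≠ ρ b := by
    intro a ha b hb hab e
    have hsh : LipschitzWith 1 (fun t => ρ (t + (b - a))) := by
      have := hρ.comp (LipschitzWith.id.add (LipschitzWith.const (b - a)))
      rw [add_zero, mul_one] at this
      exact this
    have hβ := hρ.ite_le hsh (a := a) (by simpa using e)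
    have hmem : ℓ - (b - a) ∈ pathTimesTo q K := by
      refine ⟨by linarith [ha.1, hb.2], _, hβ, by simpa [ha.1] using h0, ?_⟩
      rcases hb.2.lt_or_eq with hlt | heq
      · rw [if_neg (by linarith)]
        simpa using hK
      · rw [if_pos (by linarith), ← heq]
        simpa [e, heq] using hK
    linarith [hℓ.2 hmem]
  intro a ha b hb e
  rcases lt_trichotomy a b with h | h | h
  · exact absurd e (key a ha b hb h)
  · exact h
  · exact absurd e.symm (key b hb a ha h)

end ultralimit

/-! ### Shortest paths in a continuum of finite length. -/

section shortestPath

variable {X : Type*} [MetricSpace X] [MeasurableSpace X] [BorelSpace X]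

/-- The balls of radius `ε / 2` about the vertices of even index are disjoint, and each has measure
at least `ε / 2` by connectedness. There are `N / 2 + 1` of them, whence the constant `4`. -/
lemma exists_chain_length_le [ConnectedSpace X] (hfin : μH[1] (univ : Set X) ≠ ⊤) {ε : ℝ}
    (hε : 0 < ε) {q p : X} (hqp : ε ≤ dist q p) :
    ∃ N : ℕ, ∃ x : ℕ → X, x 0 = q ∧ x N = p ∧ (∀ i, dist (x i) (x (i + 1)) ≤ ε) ∧
      N * ε ≤ 4 * (μH[1] (univ : Set X)).toReal := by
  obtain ⟨N, x, h0, hN, hstep, hsep⟩ := exists_graph_chain hε q p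
  refine ⟨N, x, h0, hN, hstep, ?_⟩
  have hball : ∀ z : X, ENNReal.ofReal (ε / 2) ≤ μH[1] (Metric.ball z (ε / 2)) := by
    intro z
    -- No ball of radius `ε / 2` contains both `q` and `p`, so none is the whole space.
    obtain ⟨y, hy⟩ : ∃ y, ε / 2 ≤ dist y z := by
      by_contra! hcon
      have h1 := hcon q
      have h2 := hcon p
      linarith [dist_triangle_right q p z]
    simpa using (isPreconnected_univ (α := X)).ofReal_le_hausdorffMeasure_inter_ball
      (mem_univ z) (mem_univ y) hy
  have hdisj : (Finset.range (N / 2 + 1) : Set ℕ).PairwiseDisjoint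
      fun i => Metric.ball (x (2 * i)) (ε / 2) := by
    intro i hi j hj hij
    simp only [Finset.coe_range, mem_Iio] at hi hj
    refine Metric.ball_disjoint_ball ?_
    rw [add_halves]
    rcases hij.lt_or_gt with h | h
    · exact hsep _ _ (by omega) (by omega)
    · rw [dist_comm]
      exact hsep _ _ (by omega) (by omega)
  have hsum : ∑ i ∈ Finset.range (N / 2 + 1), ENNReal.ofReal (ε / 2) ≤ μH[1] (univ : Set X) := by
    calc ∑ i ∈ Finset.range (N / 2 + 1), ENNReal.ofReal (ε / 2)
        ≤ ∑ i ∈ Finset.range (N / 2 + 1), μH[1] (Metric.ball (x (2 * i)) (ε / 2)) :=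
          Finset.sum_le_sum fun i _ => hball _
      _ = μH[1] (⋃ i ∈ Finset.range (N / 2 + 1), Metric.ball (x (2 * i)) (ε / 2)) :=
          (measure_biUnion_finset hdisj fun _ _ => measurableSet_ball).symm
      _ ≤ μH[1] (univ : Set X) := measure_mono (subset_univ _)
  have h1 := ENNReal.toReal_mono hfin hsum
  rw [Finset.sum_const, Finset.card_range, nsmul_eq_mul, ENNReal.toReal_mul,
    ENNReal.toReal_natCast, ENNReal.toReal_ofReal (by positivity)] at h1
  have h2 : (N : ℝ) ≤ 2 * ((N / 2 + 1 : ℕ) : ℝ) := by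
    exact_mod_cast (by omega : N ≤ 2 * (N / 2 + 1))
  nlinarith

/-- Any two points of a continuum of finite length are joined by a Lipschitz path. -/
lemma exists_lipschitzWith_joining [CompactSpace X] [ConnectedSpace X]
    (hfin : μH[1] (univ : Set X) ≠ ⊤) (q p : X) :
    ∃ c : ℝ≥0, ∃ γ : ℝ → X, LipschitzWith c γ ∧ γ 0 = q ∧ γ 1 = p := by
  rcases eq_or_ne q p with rfl | hne
  · exact ⟨0, fun _ => q, LipschitzWith.const q, rfl, rfl⟩
  set H : ℝ≥0 := 4 * (μH[1] (univ : Set X)).toNNReal with hH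
  have hF : ∀ n : ℕ, ∃ F : ℝ → X, F 0 = q ∧ F 1 = p ∧ (1 / ((n : ℝ) + 1) ≤ dist q p →
      ∀ s t, dist (F s) (F t) ≤ H * dist s t + 1 / ((n : ℝ) + 1)) := by
    intro n
    have hε : 0 < 1 / ((n : ℝ) + 1) := by positivity
    by_cases hn : 1 / ((n : ℝ) + 1) ≤ dist q p
    · obtain ⟨N, x, h0, hN, hstep, hle⟩ := exists_chain_length_le hfin hε hn
      -- The step path along the chain is Lipschitz with constant `N ε ≤ H`, up to an error of one
      -- jump `ε = 1 / (n + 1)`.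
      refine ⟨fun t => x ⌊N * (projIcc (0 : ℝ) 1 zero_le_one t : ℝ)⌋₊, ?_, ?_, fun _ s t => ?_⟩
      · simpa using h0
      · simpa using hN
      · have hcl : dist (projIcc (0 : ℝ) 1 zero_le_one s : ℝ) (projIcc (0 : ℝ) 1 zero_le_one t) ≤
            dist s t := by
          simpa [Subtype.dist_eq] using
            (LipschitzWith.projIcc (zero_le_one (α := ℝ))).dist_le_mul s t
        have hu := (projIcc (0 : ℝ) 1 zero_le_one s).2.1
        have hv := (projIcc (0 : ℝ) 1 zero_le_one t).2.1
        beta_reduce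
        generalize (projIcc (0 : ℝ) 1 zero_le_one s : ℝ) = u at *
        generalize (projIcc (0 : ℝ) 1 zero_le_one t : ℝ) = v at *
        refine (dist_chain_le hstep _ _).trans ?_
        have hfl : |(⌊N * u⌋₊ : ℝ) - ⌊N * v⌋₊| ≤ N * dist u v + 1 := by
          have a1 := Nat.floor_le (by positivity : 0 ≤ N * u)
          have a2 := Nat.lt_floor_add_one (N * u)
          have b1 := Nat.floor_le (by positivity : 0 ≤ N * v)
          have b2 := Nat.lt_floor_add_one (N * v)
          have e : N * dist u v = |N * u - N * v| := by
            rw [← mul_sub, abs_mul, Nat.abs_cast, Real.dist_eq]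
          rw [e, abs_le]
          constructor <;> cases abs_cases (N * u - N * v) <;> linarith
        have hH' : (H : ℝ) = 4 * (μH[1] (univ : Set X)).toReal := by
          rw [hH]
          push_cast
          rfl
        calc 1 / ((n : ℝ) + 1) * |(⌊N * u⌋₊ : ℝ) - ⌊N * v⌋₊|
            ≤ 1 / ((n : ℝ) + 1) * (N * dist u v + 1) := by gcongr
          _ = (N * (1 / ((n : ℝ) + 1))) * dist u v + 1 / ((n : ℝ) + 1) := by ring
          _ ≤ H * dist s t + 1 / ((n : ℝ) + 1) := by
              rw [hH']
              gcongr
    · exact ⟨fun t => if t = 0 then q else p, by simp, by simp, fun h => absurd h hn⟩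
  choose F hF0 hF1 hFd using hF
  have hU : ((hyperfilter ℕ : Ultrafilter ℕ) : Filter ℕ) ≤ atTop := by
    rw [← Nat.cofinite_eq_atTop]
    exact hyperfilter_le_cofinite
  have he := (tendsto_one_div_add_atTop_nhds_zero_nat (𝕜 := ℝ)).mono_left hU
  obtain ⟨γ, hγ, -, hlim⟩ := exists_lipschitzWith_ultralimit (hyperfilter ℕ) isCompact_univ
    (F := F) (fun t => ⟨fun n => F n t, fun _ => mem_univ _, by simp⟩) he
    ((he.eventually_le_const (dist_pos.2 hne)).mono fun n hn => hFd n hn)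
  refine ⟨H, γ, hγ, tendsto_nhds_unique (hlim 0) ?_, tendsto_nhds_unique (hlim 1) ?_⟩
  · simp [hF0]
  · simp [hF1]

lemma hausdorffMeasure_insert_le (x : X) (S : Set X) : μH[1] (insert x S) ≤ μH[1] S := by
  have := Measure.nullSingletonClass_hausdorff X one_pos
  rw [insert_eq]
  exact (measure_union_le _ _).trans (by simp)

lemma hausdorffMeasure_image_le_volume {ρ : ℝ → X} (hρ : LipschitzWith 1 ρ) (S : Set ℝ) :
    μH[1] (ρ '' S) ≤ volume S := by
  simpa [hausdorffMeasure_real] using hρ.hausdorffMeasure_image_le zero_le_one S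

/-- A shortest path is reparametrized by the measure `φ t` of the trace up to time `t`. By
injectivity `φ` is additive along the path, and by connectedness of subarcs the new path is
1-Lipschitz. It is a competitor of duration `φ ℓ`, so `ℓ ≤ φ ℓ`. -/
lemma IsLeast.ofReal_le_hausdorffMeasure_image {q : X} {K : Set X} {ℓ : ℝ}
    (hℓ : IsLeast (pathTimesTo q K) ℓ) {ρ : ℝ → X} (hρ : LipschitzWith 1 ρ) (h0 : ρ 0 = q)
    (hK : ρ ℓ ∈ K) : ENNReal.ofReal ℓ ≤ μH[1] (ρ '' Icc 0 ℓ) := by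
  have hinj := injOn_of_isLeast_pathTimesTo hℓ hρ h0 hK
  have hℓ0 := hℓ.1.1
  have hfin : ∀ S : Set ℝ, volume S ≠ ⊤ → μH[1] (ρ '' S) ≠ ⊤ := fun S hS =>
    ((hausdorffMeasure_image_le_volume hρ S).trans_lt hS.lt_top).ne
  set φ : ℝ → ℝ := fun t => (μH[1] (ρ '' Icc 0 t)).toReal with hφ
  have hφ0 : φ 0 = 0 := by
    have := Measure.nullSingletonClass_hausdorff X one_pos
    simp [hφ]
  have hsub : ∀ s t, 0 ≤ s → s ≤ t → t ≤ ℓ → φ t - φ s = (μH[1] (ρ '' Ioc s t)).toReal := by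
    intro s t hs hst ht
    have hun : ρ '' Icc 0 t = ρ '' Icc 0 s ∪ ρ '' Ioc s t := by
      rw [← image_union, Icc_union_Ioc_eq_Icc hs hst]
    have hdisj : Disjoint (ρ '' Icc 0 s) (ρ '' Ioc s t) := by
      rw [Set.disjoint_left]
      rintro _ ⟨u, hu, rfl⟩ ⟨v, hv, e⟩
      have := hinj ⟨hs.trans hv.1.le, hv.2.trans ht⟩ ⟨hu.1, (hu.2.trans hst).trans ht⟩ e
      exact absurd hv.1 (this ▸ hu.2).not_gt
    simp only [hφ]
    rw [hun, measure_union' hdisj (isCompact_Icc.image hρ.continuous).measurableSet,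
      ENNReal.toReal_add (hfin _ (by simp)) (hfin _ (by simp))]
    ring
  have hdle : ∀ s t, 0 ≤ s → s ≤ t → t ≤ ℓ → dist (ρ s) (ρ t) ≤ φ t - φ s := by
    intro s t hs hst ht
    rw [hsub s t hs hst ht]
    have h1 := ((isPreconnected_Icc (a := s) (b := t)).image ρ
      hρ.continuous.continuousOn).edist_le_hausdorffMeasure
      (mem_image_of_mem ρ (left_mem_Icc.2 hst)) (mem_image_of_mem ρ (right_mem_Icc.2 hst))
    have h2 : μH[1] (ρ '' Icc s t) ≤ μH[1] (ρ '' Ioc s t) := by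
      rw [← Ioc_insert_left hst, image_insert_eq]
      exact hausdorffMeasure_insert_le _ _
    have h3 := ENNReal.toReal_mono (hfin _ (by simp)) (h1.trans h2)
    rwa [edist_dist, ENNReal.toReal_ofReal dist_nonneg] at h3
  have hφle : ∀ s t, 0 ≤ s → s ≤ t → t ≤ ℓ → φ t - φ s ≤ t - s := by
    intro s t hs hst ht
    rw [hsub s t hs hst ht]
    refine ENNReal.toReal_le_of_le_ofReal (by linarith) ?_
    simpa using hausdorffMeasure_image_le_volume hρ (Ioc s t)
  have hφm : ∀ s t, 0 ≤ s → s ≤ t → t ≤ ℓ → φ s ≤ φ t := fun s t hs hst ht =>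
    sub_nonneg.1 (dist_nonneg.trans (hdle s t hs hst ht))
  have hdist : ∀ s ∈ Icc 0 ℓ, ∀ t ∈ Icc 0 ℓ, dist (ρ s) (ρ t) ≤ |φ s - φ t| := by
    intro s hs t ht
    rcases le_total s t with h | h
    · rw [abs_sub_comm]
      exact (hdle s t hs.1 h ht.2).trans (le_abs_self _)
    · rw [dist_comm]
      exact (hdle t s ht.1 h hs.2).trans (le_abs_self _)
  have hφc : ContinuousOn φ (Icc 0 ℓ) := by
    refine LipschitzOnWith.continuousOn (K := 1) (LipschitzOnWith.of_dist_le_mul ?_)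
    intro s hs t ht
    rw [NNReal.coe_one, one_mul, Real.dist_eq, Real.dist_eq]
    rcases le_total s t with h | h
    · have h1 := hφle s t hs.1 h ht.2
      have h2 := hφm s t hs.1 h ht.2
      rw [abs_sub_comm, abs_sub_comm s t, abs_of_nonneg, abs_of_nonneg] <;> linarith
    · have h1 := hφle t s ht.1 h hs.2
      have h2 := hφm t s ht.1 h hs.2
      rw [abs_of_nonneg, abs_of_nonneg] <;> linarith
  have hφℓ : 0 ≤ φ ℓ := ENNReal.toReal_nonneg
  have hsurj : ∀ u ∈ Icc 0 (φ ℓ), ∃ t ∈ Icc 0 ℓ, φ t = u := by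
    have := intermediate_value_Icc hℓ0 hφc
    rw [hφ0] at this
    exact fun u hu => this hu
  choose! τ hτ hφτ using hsurj
  have hβ : LipschitzWith 1 (fun u => ρ (τ (projIcc 0 (φ ℓ) hφℓ u))) := by
    refine LipschitzWith.of_dist_le_mul fun u v => ?_
    refine (hdist _ (hτ _ (projIcc 0 (φ ℓ) hφℓ u).2) _ (hτ _ (projIcc 0 (φ ℓ) hφℓ v).2)).trans ?_
    rw [hφτ _ (projIcc 0 (φ ℓ) hφℓ u).2, hφτ _ (projIcc 0 (φ ℓ) hφℓ v).2]
    exact (LipschitzWith.projIcc hφℓ).dist_le_mul u v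
  -- `τ` is only some right inverse of `φ`, but times with equal `φ` have equal values of `ρ`.
  have hval : ∀ t ∈ Icc 0 ℓ, φ t ∈ Icc 0 (φ ℓ) → ρ (τ (φ t)) = ρ t := by
    intro t ht hφt
    have := hdist _ (hτ _ hφt) t ht
    rw [hφτ _ hφt, sub_self, abs_zero] at this
    exact dist_le_zero.1 this
  have hmem : φ ℓ ∈ pathTimesTo q K := by
    refine ⟨hφℓ, _, hβ, ?_, ?_⟩
    · have h1 := hval 0 (left_mem_Icc.2 hℓ0) (by simp [hφ0, hφℓ])
      rw [hφ0] at h1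
      simpa [h0] using h1
    · have h1 := hval ℓ (right_mem_Icc.2 hℓ0) (by simp [hφℓ])
      simpa [h1] using hK
  exact ENNReal.ofReal_le_of_le_toReal (hℓ.2 hmem)

/-- In a continuum of finite length, a point is joined to a closed set `K` by a path of speed at
most one whose trace outside `K` is as long as the path. -/
theorem exists_path_to_closed [CompactSpace X] [ConnectedSpace X]
    (hfin : μH[1] (univ : Set X) ≠ ⊤) (q : X) {K : Set X} (hK : IsClosed K) (hKne : K.Nonempty) :
    ∃ ℓ : ℝ, 0 ≤ ℓ ∧ ∃ ρ : ℝ → X, LipschitzWith 1 ρ ∧ ρ 0 = q ∧ ρ ℓ ∈ K ∧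
      ENNReal.ofReal ℓ ≤ μH[1] (ρ '' Icc 0 ℓ \ K) := by
  have hne : (pathTimesTo q K).Nonempty := by
    obtain ⟨p, hp⟩ := hKne
    obtain ⟨c, γ, hγ, h0, h1⟩ := exists_lipschitzWith_joining hfin q p
    -- Slowing down by `c + 1` instead of `c` avoids division by zero.
    have hc : (0 : ℝ) < c + 1 := by positivity
    refine ⟨c + 1, hc.le, fun t => γ (t / (c + 1)), ?_, by simpa using h0, by
      simpa [hc.ne', h1] using hp⟩
    refine LipschitzWith.of_dist_le_mul fun s t => (hγ.dist_le_mul _ _).trans ?_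
    rw [Real.dist_eq, Real.dist_eq, ← sub_div, abs_div, abs_of_pos hc, mul_div_assoc',
      div_le_iff₀ hc, NNReal.coe_one, one_mul]
    nlinarith [abs_nonneg (s - t)]
  obtain ⟨ℓ, hℓ⟩ := exists_isLeast_pathTimesTo hK hne
  obtain ⟨hℓ0, ρ, hρ, h0, hρK⟩ := hℓ.1
  refine ⟨ℓ, hℓ0, ρ, hρ, h0, hρK, (hℓ.ofReal_le_hausdorffMeasure_image hρ h0 hρK).trans ?_⟩
  -- By minimality of `ℓ` the path cannot reach `K` before its end, and a single point has measure
  -- zero.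
  have hsub : ρ '' Icc 0 ℓ ⊆ insert (ρ ℓ) (ρ '' Icc 0 ℓ \ K) := by
    rintro _ ⟨t, ht, rfl⟩
    by_cases htK : ρ t ∈ K
    · have : t = ℓ := le_antisymm ht.2 (hℓ.2 ⟨ht.1, ρ, hρ, h0, htK⟩)
      exact Or.inl (this ▸ rfl)
    · exact Or.inr ⟨⟨t, ht, rfl⟩, htK⟩
  exact (measure_mono hsub).trans (hausdorffMeasure_insert_le _ _)

end shortestPath

/-! ### Line integrals under restriction, translation, reversal and scaling. -/

section lineIntegral

variable {X : Type*}

/-- The integral `∫ₐᵇ f(γ(t)) (d/dt) g(γ(t)) dt`. -/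
noncomputable def lineIntegral (γ : ℝ → X) (f g : X → ℝ) (a b : ℝ) : ℝ :=
  ∫ t in a..b, f (γ t) * deriv (fun s => g (γ s)) t

lemma lineIntegral_congr {γ δ : ℝ → X} {a b : ℝ} (hab : a ≤ b) (h : EqOn γ δ (Ioo a b))
    (f g : X → ℝ) : lineIntegral γ f g a b = lineIntegral δ f g a b := by
  simp only [lineIntegral]
  rw [intervalIntegral.integral_of_le hab, intervalIntegral.integral_of_le hab,
    integral_Ioc_eq_integral_Ioo, integral_Ioc_eq_integral_Ioo]
  refine setIntegral_congr_fun measurableSet_Ioo fun t ht => ?_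
  have he : (fun s => g (γ s)) =ᶠ[𝓝 t] fun s => g (δ s) := by
    filter_upwards [isOpen_Ioo.mem_nhds ht] with s hs
    rw [h hs]
  simp only [h ht, he.deriv_eq]

lemma lineIntegral_comp_sub_right (γ : ℝ → X) (f g : X → ℝ) (a b d : ℝ) :
    lineIntegral (fun t => γ (t - d)) f g a b = lineIntegral γ f g (a - d) (b - d) := by
  simp only [lineIntegral]
  rw [← intervalIntegral.integral_comp_sub_right]
  refine intervalIntegral.integral_congr fun t _ => ?_
  rw [deriv_comp_sub_const (f := fun s => g (γ s))]

lemma lineIntegral_comp_sub_left (γ : ℝ → X) (f g : X → ℝ) (a b d : ℝ) :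
    lineIntegral (fun t => γ (d - t)) f g a b = -lineIntegral γ f g (d - b) (d - a) := by
  simp only [lineIntegral]
  rw [← intervalIntegral.integral_comp_sub_left, ← intervalIntegral.integral_neg]
  refine intervalIntegral.integral_congr fun t _ => ?_
  rw [deriv_comp_const_sub (f := fun s => g (γ s)), mul_neg]

lemma lineIntegral_comp_mul_left (γ : ℝ → X) (f g : X → ℝ) (T : ℝ) :
    lineIntegral (fun t => γ (T * t)) f g 0 1 = lineIntegral γ f g 0 T := by
  have h := intervalIntegral.smul_integral_comp_mul_left
    (fun t => f (γ t) * deriv (fun s => g (γ s)) t) T (a := 0) (b := 1)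
  rw [mul_zero, mul_one] at h
  simp only [lineIntegral]
  rw [← h, smul_eq_mul, ← intervalIntegral.integral_const_mul]
  refine intervalIntegral.integral_congr fun t _ => ?_
  rw [deriv_comp_mul_left T (fun s => g (γ s)), smul_eq_mul]
  ring

lemma lineIntegral_add_adjacent [MetricSpace X] {γ : ℝ → X} {c Kf Kg : ℝ≥0}
    (hγ : LipschitzWith c γ) {f g : X → ℝ} (hf : LipschitzWith Kf f) (hg : LipschitzWith Kg g)
    (a b d : ℝ) :
    lineIntegral γ f g a b + lineIntegral γ f g b d = lineIntegral γ f g a d :=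
  intervalIntegral.integral_add_adjacent_intervals
    ((hg.comp hγ).intervalIntegrable_mul_deriv (hf.continuous.comp hγ.continuous) a b)
    ((hg.comp hγ).intervalIntegrable_mul_deriv (hf.continuous.comp hγ.continuous) b d)

lemma DegreeZeroOn.comp_mul_left [MetricSpace X] {γ : ℝ → X} {T : ℝ} (h : DegreeZeroOn γ T) :
    DegreeZeroOn (fun t => γ (T * t)) 1 := fun f g hf hg =>
  (lineIntegral_comp_mul_left γ f g T).trans (h f g hf hg)

end lineIntegral

/-! ### Inserting an out-and-back excursion into a path. -/

section insertion

/-- The path `γ` interrupted at time `τ` by the excursion which runs through `ρ` backwards on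
`[0, ℓ]`, and then returns. -/
noncomputable def insertExcursion {X : Type*} (γ ρ : ℝ → X) (τ ℓ : ℝ) : ℝ → X := fun t =>
  if t ≤ τ then γ t else if t ≤ τ + 2 * ℓ then ρ |t - (τ + ℓ)| else γ (t - 2 * ℓ)

variable {X : Type*} {γ ρ : ℝ → X} {τ ℓ T : ℝ}

lemma insertExcursion_of_le {t : ℝ} (ht : t ≤ τ) : insertExcursion γ ρ τ ℓ t = γ t := if_pos ht

lemma insertExcursion_of_mem_Ioc {t : ℝ} (ht : t ∈ Ioc τ (τ + 2 * ℓ)) :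
    insertExcursion γ ρ τ ℓ t = ρ |t - (τ + ℓ)| := by
  rw [insertExcursion, if_neg ht.1.not_ge, if_pos ht.2]

lemma insertExcursion_of_lt {t : ℝ} (hℓ : 0 ≤ ℓ) (ht : τ + 2 * ℓ < t) :
    insertExcursion γ ρ τ ℓ t = γ (t - 2 * ℓ) := by
  rw [insertExcursion, if_neg (by linarith), if_neg ht.not_ge]

lemma insertExcursion_zero (hτ : τ ∈ Icc 0 T) : insertExcursion γ ρ τ ℓ 0 = γ 0 :=
  insertExcursion_of_le hτ.1

lemma insertExcursion_end (hℓ : 0 ≤ ℓ) (h : ρ ℓ = γ τ) (hτ : τ ∈ Icc 0 T) :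
    insertExcursion γ ρ τ ℓ (T + 2 * ℓ) = γ T := by
  rcases hτ.2.lt_or_eq with hlt | rfl
  · rw [insertExcursion_of_lt hℓ (by linarith), add_sub_cancel_right]
  · rcases hℓ.lt_or_eq with hℓ' | rfl
    · rw [insertExcursion_of_mem_Ioc ⟨by linarith, le_rfl⟩,
        show τ + 2 * ℓ - (τ + ℓ) = ℓ by ring, abs_of_nonneg hℓ, h]
    · rw [insertExcursion_of_le (by linarith)]
      simp

lemma subset_image_insertExcursion (hℓ : 0 ≤ ℓ) (h : ρ ℓ = γ τ) (hτ : τ ∈ Icc 0 T) :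
    γ '' Icc 0 T ∪ ρ '' Icc 0 ℓ ⊆ insertExcursion γ ρ τ ℓ '' Icc 0 (T + 2 * ℓ) := by
  have h1 : γ '' Icc 0 T ⊆ insertExcursion γ ρ τ ℓ '' Icc 0 (T + 2 * ℓ) := by
    rintro _ ⟨t, ht, rfl⟩
    rcases le_or_gt t τ with htτ | htτ
    · exact ⟨t, ⟨ht.1, by linarith [ht.2]⟩, insertExcursion_of_le htτ⟩
    · refine ⟨t + 2 * ℓ, ⟨by linarith [ht.1], by linarith [ht.2]⟩, ?_⟩
      rw [insertExcursion_of_lt hℓ (by linarith), add_sub_cancel_right]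
  refine union_subset h1 ?_
  rintro _ ⟨t, ht, rfl⟩
  rcases ht.2.lt_or_eq with hlt | rfl
  · refine ⟨t + (τ + ℓ), ⟨by linarith [ht.1, hτ.1], by linarith [hτ.2]⟩, ?_⟩
    rw [insertExcursion_of_mem_Ioc ⟨by linarith [ht.1], by linarith⟩, add_sub_cancel_right,
      abs_of_nonneg ht.1]
  · rw [h]
    exact h1 (mem_image_of_mem γ hτ)

variable [MetricSpace X]

lemma LipschitzWith.insertExcursion (hγ : LipschitzWith 1 γ) (hρ : LipschitzWith 1 ρ)
    (hℓ : 0 ≤ ℓ) (h : ρ ℓ = γ τ) : LipschitzWith 1 (insertExcursion γ ρ τ ℓ) := by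
  have h1 : LipschitzWith 1 (fun t => ρ |t - (τ + ℓ)|) := by
    refine LipschitzWith.of_dist_le_mul fun s t => (hρ.dist_le_mul _ _).trans ?_
    gcongr
    rw [Real.dist_eq, Real.dist_eq]
    refine (abs_abs_sub_abs_le_abs_sub _ _).trans_eq ?_
    congr 1
    ring
  have h2 : LipschitzWith 1 (fun t => γ (t - 2 * ℓ)) := by
    refine LipschitzWith.of_dist_le_mul fun s t => (hγ.dist_le_mul _ _).trans ?_
    simp
  refine hγ.ite_le (h1.ite_le h2 ?_) ?_
  · rw [show τ + 2 * ℓ - (τ + ℓ) = ℓ by ring, abs_of_nonneg hℓ, h, add_sub_cancel_right]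
  · rw [if_pos (by linarith), show τ - (τ + ℓ) = -ℓ by ring, abs_neg, abs_of_nonneg hℓ, h]

/-- The two passes through `ρ` have opposite orientations and cancel; the rest is the integral along
`γ`, cut at `τ`. -/
lemma DegreeZeroOn.insertExcursion (hdeg : DegreeZeroOn γ T) (hγ : LipschitzWith 1 γ)
    (hρ : LipschitzWith 1 ρ) (hℓ : 0 ≤ ℓ) (h : ρ ℓ = γ τ) (hτ : τ ∈ Icc 0 T) :
    DegreeZeroOn (insertExcursion γ ρ τ ℓ) (T + 2 * ℓ) := by
  rintro f g ⟨Kf, hf⟩ ⟨Kg, hg⟩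
  change lineIntegral _ f g 0 (T + 2 * ℓ) = 0
  have h0 : lineIntegral γ f g 0 T = 0 := hdeg f g ⟨Kf, hf⟩ ⟨Kg, hg⟩
  have hδ := hγ.insertExcursion hρ hℓ h
  rw [← lineIntegral_add_adjacent hδ hf hg 0 (τ + 2 * ℓ),
    ← lineIntegral_add_adjacent hδ hf hg 0 (τ + ℓ), ← lineIntegral_add_adjacent hδ hf hg 0 τ]
  have e1 : lineIntegral (_root_.insertExcursion γ ρ τ ℓ) f g 0 τ = lineIntegral γ f g 0 τ :=
    lineIntegral_congr hτ.1 (fun t ht => insertExcursion_of_le ht.2.le) f g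
  have e2 : lineIntegral (_root_.insertExcursion γ ρ τ ℓ) f g τ (τ + ℓ) =
      -lineIntegral ρ f g 0 ℓ := by
    rw [lineIntegral_congr (δ := fun t => ρ (τ + ℓ - t)) (by linarith) (fun t ht => ?_) f g,
      lineIntegral_comp_sub_left, sub_self, add_sub_cancel_left]
    rw [insertExcursion_of_mem_Ioc ⟨ht.1, by linarith [ht.2]⟩, abs_sub_comm,
      abs_of_nonneg (by linarith [ht.2])]
  have e3 : lineIntegral (_root_.insertExcursion γ ρ τ ℓ) f g (τ + ℓ) (τ + 2 * ℓ) =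
      lineIntegral ρ f g 0 ℓ := by
    rw [lineIntegral_congr (δ := fun t => ρ (t - (τ + ℓ))) (by linarith) (fun t ht => ?_) f g,
      lineIntegral_comp_sub_right, sub_self, show τ + 2 * ℓ - (τ + ℓ) = ℓ by ring]
    rw [insertExcursion_of_mem_Ioc ⟨by linarith [ht.1], ht.2.le⟩,
      abs_of_nonneg (by linarith [ht.1])]
  have e4 : lineIntegral (_root_.insertExcursion γ ρ τ ℓ) f g (τ + 2 * ℓ) (T + 2 * ℓ) =
      lineIntegral γ f g τ T := by
    rw [lineIntegral_congr (δ := fun t => γ (t - 2 * ℓ)) (by linarith [hτ.2]) (fun t ht => ?_) f g,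
      lineIntegral_comp_sub_right, add_sub_cancel_right, add_sub_cancel_right]
    exact insertExcursion_of_lt hℓ ht.1
  rw [e1, e2, e3, e4]
  linarith [lineIntegral_add_adjacent hγ hf hg 0 τ T]

end insertion

/-! ### Tours through finite sets and their limit. -/

section tour

variable {X : Type*} [MetricSpace X] [MeasurableSpace X] [BorelSpace X]

/-- A closed path of degree zero on `[0, T]`, with speed at most one, which covers its image
at most twice on average. -/
structure IsTour (γ : ℝ → X) (T : ℝ) : Prop where
  lipschitz : LipschitzWith 1 γ
  nonneg : 0 ≤ T
  closed : γ 0 = γ T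
  degreeZero : DegreeZeroOn γ T
  le_two_mul : ENNReal.ofReal T ≤ 2 * μH[1] (γ '' Icc 0 T)

/-- The excursion to `q` along a shortest path takes time `2ℓ` and adds at least `ℓ` to the measure
of the image, which preserves the bound on `T`. -/
lemma IsTour.exists_extension [CompactSpace X] [ConnectedSpace X]
    (hfin : μH[1] (univ : Set X) ≠ ⊤) {γ : ℝ → X} {T : ℝ} (h : IsTour γ T) (q : X) :
    ∃ (γ' : ℝ → X) (T' : ℝ), IsTour γ' T' ∧ insert q (γ '' Icc 0 T) ⊆ γ' '' Icc 0 T' := by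
  have hc : IsCompact (γ '' Icc 0 T) := isCompact_Icc.image h.lipschitz.continuous
  obtain ⟨ℓ, hℓ, ρ, hρ, hρ0, ⟨τ, hτ, hρℓ⟩, hle⟩ := exists_path_to_closed hfin q hc.isClosed
    ((nonempty_Icc.2 h.nonneg).image γ)
  have hsub := subset_image_insertExcursion hℓ hρℓ.symm hτ
  refine ⟨insertExcursion γ ρ τ ℓ, T + 2 * ℓ,
    ⟨h.lipschitz.insertExcursion hρ hℓ hρℓ.symm, by linarith [h.nonneg], ?_,
      h.degreeZero.insertExcursion h.lipschitz hρ hℓ hρℓ.symm hτ, ?_⟩, ?_⟩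
  · rw [insertExcursion_zero hτ, insertExcursion_end hℓ hρℓ.symm hτ, h.closed]
  · calc ENNReal.ofReal (T + 2 * ℓ)
        = ENNReal.ofReal T + 2 * ENNReal.ofReal ℓ := by
          rw [ENNReal.ofReal_add h.nonneg (by positivity), ENNReal.ofReal_mul zero_le_two,
            ENNReal.ofReal_ofNat]
      _ ≤ 2 * μH[1] (γ '' Icc 0 T) + 2 * μH[1] (ρ '' Icc 0 ℓ \ γ '' Icc 0 T) := by
          gcongr
          exact h.le_two_mul
      _ = 2 * μH[1] (γ '' Icc 0 T ∪ ρ '' Icc 0 ℓ) := by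
          rw [← mul_add, ← measure_union' disjoint_sdiff_right hc.measurableSet, union_sdiff_self]
      _ ≤ 2 * μH[1] (insertExcursion γ ρ τ ℓ '' Icc 0 (T + 2 * ℓ)) := by
          gcongr
  · refine insert_subset (hsub (Or.inr ⟨0, left_mem_Icc.2 hℓ, hρ0⟩))
      (subset_union_left.trans hsub)

lemma exists_isTour_through_finset [CompactSpace X] [ConnectedSpace X]
    (hfin : μH[1] (univ : Set X) ≠ ⊤) (F : Finset X) :
    ∃ (γ : ℝ → X) (T : ℝ), IsTour γ T ∧ (F : Set X) ⊆ γ '' Icc 0 T := by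
  classical
  induction F using Finset.induction_on with
  | empty =>
    obtain ⟨x⟩ := (inferInstance : Nonempty X)
    exact ⟨fun _ => x, 0, ⟨LipschitzWith.const' x, le_rfl, rfl, fun f g _ _ => by simp, by simp⟩,
      by simp⟩
  | insert q F _ ih =>
    obtain ⟨γ, T, h, hF⟩ := ih
    obtain ⟨γ', T', h', hsub⟩ := h.exists_extension hfin q
    refine ⟨γ', T', h', ?_⟩
    rw [Finset.coe_insert]
    exact (insert_subset_insert hF).trans hsub

/-- A continuum of finite length is the image of a closed path of degree zero whose speed is at
most twice the length of the continuum. -/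
theorem exists_degreeZeroOn_surjective [CompactSpace X] [ConnectedSpace X]
    (hfin : μH[1] (univ : Set X) ≠ ⊤) :
    ∃ γ : ℝ → X, LipschitzWith (2 * (μH[1] (univ : Set X)).toNNReal) γ ∧ γ 0 = γ 1 ∧
      γ '' Icc 0 1 = univ ∧ DegreeZeroOn γ 1 := by
  classical
  set c : ℝ≥0 := 2 * (μH[1] (univ : Set X)).toNNReal with hc
  choose γ T hγ hF using exists_isTour_through_finset hfin
  set G : Finset X → ℝ → X := fun F t => γ F (T F * t) with hG
  have hTc : ∀ F, T F ≤ c := by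
    intro F
    have h1 : ENNReal.ofReal (T F) ≤ c := by
      rw [hc, ENNReal.coe_mul, ENNReal.coe_toNNReal hfin]
      exact (hγ F).le_two_mul.trans (mul_le_mul' le_rfl (measure_mono (subset_univ _)))
    have := (ENNReal.ofReal_le_iff_le_toReal ENNReal.coe_ne_top).1 h1
    simpa using this
  have hGl : ∀ F, LipschitzWith c (G F) := fun F =>
    LipschitzWith.of_dist_le_mul fun s t => by
      refine ((hγ F).lipschitz.dist_le_mul _ _).trans ?_
      rw [NNReal.coe_one, one_mul, Real.dist_eq, Real.dist_eq, ← mul_sub, abs_mul,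
        abs_of_nonneg (hγ F).nonneg]
      exact mul_le_mul_of_nonneg_right (hTc F) (abs_nonneg _)
  -- Along `U` each point of `X` eventually belongs to the finite set, hence to the image of the
  -- tour; this makes the limit surjective.
  set U : Ultrafilter (Finset X) := Ultrafilter.of atTop
  have hU : (U : Filter (Finset X)) ≤ atTop := Ultrafilter.of_le _
  obtain ⟨δ, hδ, -, hlim⟩ := exists_lipschitzWith_ultralimit U isCompact_univ
    (F := G) (c := c) (e := fun _ => 0) (fun t => ⟨fun F => G F t, fun _ => mem_univ _, by simp⟩)
    tendsto_const_nhds (Eventually.of_forall fun F s t => by simpa using (hGl F).dist_le_mul s t)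
  have hunif := tendstoUniformlyOn_of_lipschitzWith (Eventually.of_forall hGl) hδ hlim
    (isCompact_Icc (a := (0 : ℝ)) (b := 1))
  refine ⟨δ, hδ, ?_, ?_, ?_⟩
  · refine tendsto_nhds_unique (hlim 0) ((hlim 1).congr fun F => ?_)
    simp [hG, (hγ F).closed]
  · refine eq_univ_of_forall fun x => mem_image_of_tendstoUniformlyOn hδ.continuous isCompact_Icc
      hunif fun ε hε => ?_
    filter_upwards [hU (eventually_ge_atTop {x})] with F hxF
    obtain ⟨t, ht, hx⟩ := hF F (Finset.singleton_subset_iff.1 hxF)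
    -- A tour of duration `0` cannot be rescaled by division; its only time is `0`.
    rcases (hγ F).nonneg.lt_or_eq with hT | hT
    · refine ⟨t / T F, ⟨div_nonneg ht.1 hT.le, (div_le_one hT).2 ht.2⟩, ?_⟩
      simp only [hG]
      rwa [mul_div_cancel₀ _ hT.ne', hx, dist_self]
    · rw [← hT, Icc_self, mem_singleton_iff] at ht
      refine ⟨0, by simp, ?_⟩
      simp only [hG]
      rwa [mul_zero, ← ht, hx, dist_self]
  · exact DegreeZeroOn.of_tendstoUniformlyOn (Eventually.of_forall hGl) hδ
      (Eventually.of_forall fun F => (hγ F).degreeZero.comp_mul_left) hunif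

end tour

/-! ### Constant speed and multiplicity two from equality of the length bounds. -/

section parametrization

variable {X : Type*} [MetricSpace X]

lemma pathLengthOn_comp_coe (γ : ℝ → X) (t₀ t₁ : I) :
    pathLengthOn (fun t : I => γ t) t₀ t₁ = eVariationOn γ (Icc (t₀ : ℝ) t₁) := by
  have h := eVariationOn.comp_eq_of_monotoneOn γ (t := Icc t₀ t₁) (Subtype.val : I → ℝ)
    ((Subtype.mono_coe _).monotoneOn _)
  have himg : (Subtype.val : I → ℝ) '' Icc t₀ t₁ = Icc (t₀ : ℝ) t₁ := by
    ext t
    constructor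
    · rintro ⟨s, hs, rfl⟩
      exact hs
    · exact fun ht => ⟨⟨t, t₀.2.1.trans ht.1, ht.2.trans t₁.2.2⟩, ht, rfl⟩
  rw [himg] at h
  exact h

lemma DegreeZeroOn.hasDegreeZero {γ : ℝ → X} (h : DegreeZeroOn γ 1) :
    HasDegreeZero (fun t : I => γ t) := fun f g hf hg => by
  have hcongr : EqOn (IccExtend zero_le_one fun t : I => γ t) γ (Ioo 0 1) := fun t ht =>
    IccExtend_of_mem _ _ (Ioo_subset_Icc_self ht)
  exact (lineIntegral_congr zero_le_one hcongr f g).trans (h f g hf hg)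

/-- A path with speed at most `c` and total length at least `c` has constant speed. -/
lemma LipschitzWith.hasConstantSpeed {γ : ℝ → X} {c : ℝ≥0} (hγ : LipschitzWith c γ)
    (h : (c : ℝ≥0∞) ≤ eVariationOn γ (Icc 0 1)) : HasConstantSpeed (fun t : I => γ t) c := by
  intro a b hab
  have hab' : (a : ℝ) ≤ b := hab
  rw [pathLengthOn_comp_coe]
  refine le_antisymm (hγ.eVariationOn_Icc_le a b) ?_
  have e1 := eVariationOn.Icc_add_Icc γ (s := univ) a.2.1 a.2.2 (mem_univ _)
  have e2 := eVariationOn.Icc_add_Icc γ (s := univ) hab' b.2.2 (mem_univ _)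
  simp only [univ_inter] at e1 e2
  have h0 := hγ.eVariationOn_Icc_le 0 a
  have h1 := hγ.eVariationOn_Icc_le b 1
  have hsum : c * ENNReal.ofReal (a - 0) + (c * ENNReal.ofReal (b - a) +
      c * ENNReal.ofReal (1 - b)) = (c : ℝ≥0∞) := by
    rw [← mul_add, ← mul_add, ← ENNReal.ofReal_add (by linarith) (by linarith [b.2.2]),
      ← ENNReal.ofReal_add (by linarith [a.2.1]) (by linarith [a.2.2])]
    simp
  -- The pieces before `a` and after `b` have speed at most `c`, so they cannot make up for a
  -- deficit on `[a, b]`.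
  have hle : c * ENNReal.ofReal (a - 0) + (c * ENNReal.ofReal (b - a) +
      c * ENNReal.ofReal (1 - b)) ≤ c * ENNReal.ofReal (a - 0) +
      (eVariationOn γ (Icc (a : ℝ) b) + c * ENNReal.ofReal (1 - b)) := by
    rw [hsum]
    refine h.trans ?_
    rw [← e1, ← e2]
    gcongr
  have hf : ∀ x : ℝ, c * ENNReal.ofReal x ≠ ⊤ := fun x =>
    ENNReal.mul_ne_top ENNReal.coe_ne_top ENNReal.ofReal_ne_top
  exact (ENNReal.add_le_add_iff_right (hf _)).1 ((ENNReal.add_le_add_iff_left (hf _)).1 hle)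

lemma encard_le_limMultiplicity {X : Type*} (γ : ℝ → X) (x : X) (N : ℕ)
    (h : (N : ℕ∞) ≤ pathMultiplicity (fun t : I => γ t) x) : (N : ℝ≥0∞) ≤ limMultiplicity γ x := by
  obtain ⟨S, hS, hcard⟩ := exists_subset_encard_eq h
  have hfin : S.Finite := finite_of_encard_eq_coe hcard
  have hc := card_le_limMultiplicity (γ := γ) (x := x)
    (F := hfin.toFinset.map ⟨Subtype.val, Subtype.val_injective⟩) (fun t ht => ?_) (fun t ht => ?_)
  · rw [Finset.card_map] at hc
    rw [hfin.encard_eq_coe_toFinset_card] at hcard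
    rwa [Nat.cast_inj.1 hcard] at hc
  · obtain ⟨s, -, rfl⟩ := Finset.mem_map.1 ht
    exact s.2
  · obtain ⟨s, hs, rfl⟩ := Finset.mem_map.1 ht
    exact hS (hfin.mem_toFinset.1 hs)

/-- A Lipschitz path of degree zero covers its image exactly twice, almost everywhere, if its
length is at most twice the length of the image. -/
lemma DegreeZeroOn.ae_pathMultiplicity_eq_two [MeasurableSpace X] [BorelSpace X]
    (hfin : μH[1] (univ : Set X) ≠ ⊤) {γ : ℝ → X} {c : ℝ≥0} (hγ : LipschitzWith c γ)
    (hdeg : DegreeZeroOn γ 1) (hsurj : γ '' Icc 0 1 = univ)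
    (hlen : eVariationOn γ (Icc 0 1) ≤ 2 * μH[1] (univ : Set X)) :
    ∀ᵐ x ∂(μH[1] : Measure X), pathMultiplicity (fun t : I => γ t) x = 2 := by
  have h2 : ∀ᵐ x ∂(μH[1] : Measure X), 2 ≤ limMultiplicity γ x := by
    filter_upwards [hdeg.ae_two_le_limMultiplicity hγ] with x hx
    exact hx (hsurj ▸ mem_univ x)
  -- The limit multiplicity is at least `2` a.e., while its integral is at most the finite integral
  -- of `2`.
  have heq : (fun _ => 2) =ᵐ[μH[1]] limMultiplicity γ := by
    refine ae_eq_of_ae_le_of_lintegral_le h2 ?_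
      (measurable_limMultiplicity hγ.continuous).aemeasurable ?_
    · rw [lintegral_const]
      exact ENNReal.mul_ne_top ENNReal.ofNat_ne_top hfin
    · rw [lintegral_const]
      exact (lintegral_limMultiplicity_le hγ).trans hlen
  filter_upwards [heq, hdeg.ae_two_preimages hγ] with x hx hpre
  refine le_antisymm ?_ ?_
  · by_contra hlt
    have h3 : ((3 : ℕ) : ℕ∞) ≤ pathMultiplicity (fun t : I => γ t) x := by
      have := Order.add_one_le_of_lt (not_le.1 hlt)
      exact_mod_cast this
    have := encard_le_limMultiplicity γ x 3 h3
    rw [← hx] at this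
    norm_num at this
  · obtain ⟨t, ht, s, hs, hne, et, es⟩ := hpre (hsurj ▸ mem_univ x)
    have hne' : (⟨t, ht⟩ : I) ≠ ⟨s, hs⟩ := fun h => hne (congrArg Subtype.val h)
    rw [← encard_pair hne']
    refine encard_le_encard ?_
    rintro u (rfl | rfl)
    exacts [et, es]

/-- Parametrization of continua of finite length. -/
theorem exists_constantSpeed_parametrization [MeasurableSpace X] [BorelSpace X] [CompactSpace X]
    [ConnectedSpace X] (hfin : μH[1] (univ : Set X) < ⊤) :
    ∃ γ : C(I, X),
      (γ 0 = γ 1 ∧ (∃ K : ℝ≥0, LipschitzWith K γ) ∧ Function.Surjective γ ∧ HasDegreeZero γ) ∧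
      ((∀ᵐ x ∂(μH[1] : Measure X), pathMultiplicity γ x = 2) ∧
        pathLength γ = 2 * μH[1] (univ : Set X)) ∧
      HasConstantSpeed γ (2 * (μH[1] (univ : Set X)).toNNReal) := by
  obtain ⟨γ, hγ, h01, hsurj, hdeg⟩ := exists_degreeZeroOn_surjective hfin.ne
  have hc : ((2 * (μH[1] (univ : Set X)).toNNReal : ℝ≥0) : ℝ≥0∞) = 2 * μH[1] (univ : Set X) := by
    rw [ENNReal.coe_mul, ENNReal.coe_toNNReal hfin.ne, ENNReal.coe_ofNat]
  have hle : eVariationOn γ (Icc 0 1) ≤ 2 * μH[1] (univ : Set X) := by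
    have := hγ.eVariationOn_Icc_le 0 1
    rwa [hc, sub_zero, ENNReal.ofReal_one, mul_one] at this
  have hge : 2 * μH[1] (univ : Set X) ≤ eVariationOn γ (Icc 0 1) := by
    have := hdeg.two_mul_hausdorffMeasure_image_le hγ
    rwa [hsurj] at this
  refine ⟨⟨fun t => γ t, hγ.continuous.comp continuous_subtype_val⟩,
    ⟨by simpa using h01, ⟨_, hγ.comp (LipschitzWith.subtype_val _)⟩, fun x => ?_,
      hdeg.hasDegreeZero⟩,
    ⟨hdeg.ae_pathMultiplicity_eq_two hfin.ne hγ hsurj hle, ?_⟩,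
    hγ.hasConstantSpeed (hc.trans_le hge)⟩
  · obtain ⟨t, ht, hx⟩ : x ∈ γ '' Icc 0 1 := hsurj ▸ mem_univ x
    exact ⟨⟨t, ht⟩, hx⟩
  · refine (pathLengthOn_comp_coe γ 0 1).trans ?_
    simpa using le_antisymm hle hge

end parametrization

/-! ### Gołąb's theorem. -/

section semicontinuity

variable {X : Type*} [MetricSpace X] [MeasurableSpace X] [BorelSpace X]

lemma IsCompact.exists_degreeZeroOn_image_eq {K : Set X} (hK : IsCompact K) (hconn : IsConnected K)
    (hfin : μH[1] K ≠ ⊤) :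
    ∃ γ : ℝ → X, (∀ t, γ t ∈ K) ∧ LipschitzWith (2 * (μH[1] K).toNNReal) γ ∧
      γ '' Icc 0 1 = K ∧ DegreeZeroOn γ 1 := by
  have := isCompact_iff_compactSpace.1 hK
  have := isConnected_iff_connectedSpace.1 hconn
  have hμ : μH[1] (univ : Set K) = μH[1] K := by
    rw [← isometry_subtype_coe.hausdorffMeasure_image (Or.inl zero_le_one), image_univ,
      Subtype.range_coe]
  obtain ⟨γ, hγ, -, hsurj, hdeg⟩ := exists_degreeZeroOn_surjective (X := K) (hμ ▸ hfin)
  refine ⟨fun t => γ t, fun t => (γ t).2, fun s t => ?_, ?_, fun f g hf hg => ?_⟩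
  · have := hγ s t
    rwa [hμ] at this
  · rw [← image_image (fun x : K => (x : X)) γ, hsurj, image_univ, Subtype.range_coe]
  · obtain ⟨Kf, hf⟩ := hf
    obtain ⟨Kg, hg⟩ := hg
    exact hdeg (fun x => f x) (fun x => g x) ⟨_, hf.comp (LipschitzWith.subtype_val K)⟩
      ⟨_, hg.comp (LipschitzWith.subtype_val K)⟩

lemma TopologicalSpace.NonemptyCompacts.exists_dist_le {X : Type*} [MetricSpace X]
    {K L : NonemptyCompacts X} {x : X}
    (hx : x ∈ (K : Set X)) : ∃ y ∈ (L : Set X), dist x y ≤ dist K L := by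
  obtain ⟨y, hy, hxy⟩ := L.isCompact.exists_infDist_eq_dist L.nonempty x
  refine ⟨y, hy, ?_⟩
  have h := (Metric.lipschitz_infDist_set x).dist_le_mul K L
  rw [Metric.infDist_zero_of_mem hx, NNReal.coe_one, one_mul, dist_zero_left,
    Real.norm_of_nonneg Metric.infDist_nonneg] at h
  exact hxy ▸ h

/-- **Gołąb's theorem**: the length is lower semicontinuous on compact connected sets. -/
theorem lowerSemicontinuousOn_hausdorffMeasure_one :
    LowerSemicontinuousOn (fun K : NonemptyCompacts X => μH[1] (K : Set X))
      {K : NonemptyCompacts X | IsConnected (K : Set X)} := by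
  intro K₀ _ y hy
  by_contra hcon
  have hy' : y ≠ ⊤ := (hy.trans_le le_top).ne
  -- If semicontinuity fails at the level `y`, connected sets of measure at most `y` accumulate at
  -- `K₀`, so this filter is proper.
  set G : Filter (NonemptyCompacts X) :=
    𝓝[{K | IsConnected (K : Set X)}] K₀ ⊓ 𝓟 {K | μH[1] (K : Set X) ≤ y} with hG
  have hNe : G.NeBot := by
    rw [hG, ← frequently_iff_neBot]
    exact (not_eventually.1 hcon).mono fun K hK => not_lt.1 hK
  set U : Ultrafilter (NonemptyCompacts X) := Ultrafilter.of G
  have hUG : (U : Filter (NonemptyCompacts X)) ≤ G := Ultrafilter.of_le _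
  have hUK : Tendsto (fun K : NonemptyCompacts X => dist K K₀) U (𝓝 0) := by
    rw [← tendsto_iff_dist_tendsto_zero]
    exact hUG.trans (inf_le_left.trans nhdsWithin_le_nhds)
  have hconn : ∀ᶠ K : NonemptyCompacts X in U, IsConnected (K : Set X) :=
    (hUG.trans inf_le_left) self_mem_nhdsWithin
  have hle : ∀ᶠ K : NonemptyCompacts X in U, μH[1] (K : Set X) ≤ y :=
    (hUG.trans inf_le_right) (mem_principal_self _)
  set c : ℝ≥0 := 2 * y.toNNReal with hc
  have hpath : ∀ K : NonemptyCompacts X, ∃ γ : ℝ → X, (∀ t, γ t ∈ (K : Set X)) ∧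
      (IsConnected (K : Set X) → μH[1] (K : Set X) ≤ y →
        LipschitzWith c γ ∧ γ '' Icc 0 1 = K ∧ DegreeZeroOn γ 1) := by
    intro K
    by_cases h : IsConnected (K : Set X) ∧ μH[1] (K : Set X) ≤ y
    · obtain ⟨γ, hmem, hγ, him, hdeg⟩ :=
        K.isCompact.exists_degreeZeroOn_image_eq h.1 (h.2.trans_lt hy'.lt_top).ne
      exact ⟨γ, hmem, fun _ _ => ⟨hγ.weaken
        (mul_le_mul_right (ENNReal.toNNReal_mono hy' h.2) 2), him, hdeg⟩⟩
    -- Sets outside the family get a constant path inside `K`, so that `F K t` approaches `K₀` with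
    -- no condition on `K`.
    · obtain ⟨x, hx⟩ := K.nonempty
      exact ⟨fun _ => x, fun _ => hx, fun h1 h2 => absurd ⟨h1, h2⟩ h⟩
  choose F hFmem hF using hpath
  have hFl : ∀ᶠ K in (U : Filter _), LipschitzWith c (F K) := by
    filter_upwards [hconn, hle] with K h1 h2 using (hF K h1 h2).1
  have hnear : ∀ t, ∃ k : NonemptyCompacts X → X, (∀ K, k K ∈ (K₀ : Set X)) ∧
      Tendsto (fun K => dist (k K) (F K t)) U (𝓝 0) := by
    intro t
    choose k hk hkd using fun K => NonemptyCompacts.exists_dist_le (L := K₀) (hFmem K t)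
    refine ⟨k, hk, squeeze_zero (fun _ => dist_nonneg) (fun K => ?_) hUK⟩
    rw [dist_comm]
    exact hkd K
  obtain ⟨γ, hγ, -, hlim⟩ := exists_lipschitzWith_ultralimit U K₀.isCompact (F := F) (c := c)
    (e := fun _ => 0) hnear tendsto_const_nhds
    (hFl.mono fun K hK s t => by simpa using hK.dist_le_mul s t)
  have hunif := tendstoUniformlyOn_of_lipschitzWith hFl hγ hlim
    (isCompact_Icc (a := (0 : ℝ)) (b := 1))
  have hdeg : DegreeZeroOn γ 1 := by
    refine DegreeZeroOn.of_tendstoUniformlyOn hFl hγ ?_ hunif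
    filter_upwards [hconn, hle] with K h1 h2 using (hF K h1 h2).2.2
  -- Each point of `K₀` is within `dist K₀ K` of a point of `K`, which the path `F K` attains.
  have hsub : (K₀ : Set X) ⊆ γ '' Icc 0 1 := by
    intro x hx
    refine mem_image_of_tendstoUniformlyOn hγ.continuous isCompact_Icc hunif fun ε hε => ?_
    filter_upwards [hconn, hle, hUK.eventually_lt_const hε] with K h1 h2 h3
    obtain ⟨z, hz, hxz⟩ := NonemptyCompacts.exists_dist_le (L := K) hx
    obtain ⟨t, ht, rfl⟩ : z ∈ F K '' Icc 0 1 := (hF K h1 h2).2.1 ▸ hz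
    exact ⟨t, ht, hxz.trans_lt (by rwa [dist_comm])⟩
  have h2 : 2 * μH[1] (K₀ : Set X) ≤ 2 * y := by
    calc 2 * μH[1] (K₀ : Set X) ≤ 2 * μH[1] (γ '' Icc 0 1) := by gcongr
      _ ≤ eVariationOn γ (Icc 0 1) := hdeg.two_mul_hausdorffMeasure_image_le hγ
      _ ≤ c * ENNReal.ofReal (1 - 0) := hγ.eVariationOn_Icc_le 0 1
      _ = 2 * y := by
          rw [sub_zero, ENNReal.ofReal_one, mul_one, hc, ENNReal.coe_mul,
            ENNReal.coe_toNNReal hy', ENNReal.coe_ofNat]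
  exact hy.not_ge ((ENNReal.mul_le_mul_iff_right two_ne_zero ENNReal.ofNat_ne_top).1 h2)

end semicontinuity

end

theorem mainTheorem7 (X : Type*) [MetricSpace X] [MeasurableSpace X] [BorelSpace X] :
    (CompactSpace X → ConnectedSpace X → μH[1] (univ : Set X) < ⊤ →
      ∃ γ : C(I, X),
        (γ 0 = γ 1 ∧ (∃ K : ℝ≥0, LipschitzWith K γ) ∧ Function.Surjective γ ∧
          HasDegreeZero γ) ∧
        ((∀ᵐ x ∂(μH[1] : Measure X), pathMultiplicity γ x = 2) ∧
          pathLength γ = 2 * μH[1] (univ : Set X)) ∧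
        HasConstantSpeed γ (2 * (μH[1] (univ : Set X)).toNNReal)) ∧
    LowerSemicontinuousOn (fun K : NonemptyCompacts X => μH[1] (K : Set X))
      {K : NonemptyCompacts X | IsConnected (K : Set X)} :=
  ⟨fun _ _ hfin => exists_constantSpeed_parametrization hfin,
    lowerSemicontinuousOn_hausdorffMeasure_one⟩
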